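/- **Conventions.** An effect algebra is a partial algebra $(E;+,0,1)$ such that (i) $+$ is commutative and (ii) associative, where in each law one side is defined iff the other is; (iii) every $a\in E$ has a unique $a^-\in E$ with $a+a^-=1$; (iv) if $a+1$ is defined, then $a=0$. Put $a\le b$ iff $a+c=b$ for some $c$, and write $c=b-a$. A homomorphism preserves $1$ and all defined sums; an isomorphism ($\cong$) is a bijection that is a homomorphism together with its inverse. $E$ has the Riesz Decomposition Property (RDP) if $a_1+a_2=b_1+b_2$ implies that there are $c_{ij}\in E$ with $a_i=c_{i1}+c_{i2}$, $b_j=c_{1j}+c_{2j}$ ($i,j\in\{1,2\}$). An Abelian po-group $G$ has RDP if the same holds for its positive cone $G^+$. A unital po-group $(H,u)$ is a po-group $H$ with a strong unit $u$, i.e. $u\ge 0$ and for each $h\in H$ there is an integer $n\ge0$ with $h\le nu$. For $u\in H^+$ let $\Gamma(H,u)=\{h\in H:0\le h\le u\}$ be the effect algebra whose sum is that of $H$ whenever it is $\le u$. $H\overrightarrow{\times}G$ is the lexicographic product: $(h,g)\le(h',g')$ iff $h<h'$, or $h=h'$ and $g\le g'$. An ideal of $E$ is a nonempty subset that is closed downwards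 and under defined sums; $\langle I\rangle$ is the effect subalgebra of $E$ generated by $I$ (effect subalgebras are the subsets that contain $1$ and are closed under $^-$ and under defined sums). If $E$ has RDP and $I$ is an ideal, then $a\sim_I b$ iff $a-e=b-f$ for some $e,f\in I$ with $e\le a$, $f\le b$ defines an equivalence, and the set $E/I$ of its classes $x/I$ is an effect algebra, in which $A+B$ is defined iff $a+b$ is defined for some $a\in A$, $b\in B$, and then $A+B=(a+b)/I$. Let $\pi_I:E\to E/I$ be the canonical projection. $I$ is strict if $x/I<y/I$ implies $x<y$; it is retractive if there is a homomorphism $\delta:E/I\to E$ with $\pi_I\circ\delta=\mathrm{id}_{E/I}$. For an Abelian unital po-group $(H,u)$ let $[0,u]=\{t\in H:0\le t\le u\}$. An effect algebra $E$ with RDP is strong $(H,u)$-perfect if there are a partition $(E_t:t\in[0,u])$ of $E$ into nonempty sets and elements $c_t\in E_t$ such that - $\{x^-:x\in E_t\}=E_{u-t}$; and if $x\in E_s$, $y\in E_t$ and $x+y$ is defined, then $s+t\le u$ and $x+y\in E_{s+t}$; - $x\le y$ whenever $x\in E_s$, $y\in E_t$ and $s<t$; and each $E_t$ is upwards and downwards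 directed; - $c_s+c_t$ is defined and equal to $c_{s+t}$ whenever $s+t\le u$; and $c_u=1$. **Theorem 6.7.** 1. Let $E$ be an effect algebra with RDP and let $I\ne E$ be an ideal of $E$ that is strict and retractive. Then there is an Abelian unital po-group $(H,u)$ with RDP such that $E/I\cong\Gamma(H,u)$, and there is an Abelian directed po-group $G$ with RDP such that $\langle I\rangle\cong\Gamma(\mathbb Z\overrightarrow{\times}G,(1,0))$ and $E\cong\Gamma(H\overrightarrow{\times}G,(u,0))$. 2. Conversely, let $E$ be an effect algebra with $E\cong\Gamma(H\overrightarrow{\times}G,(u,0))$, where $(H,u)$ is a nontrivial ($H\neq\{0\}$) Abelian unital po-group with RDP and $G$ is an Abelian directed po-group with RDP. Then $E$ has RDP, and it has a strict and retractive ideal $I\neq E$ such that $E/I\cong\Gamma(H,u)$ and $\langle I\rangle\cong\Gamma(\mathbb Z\overrightarrow{\times}G,(1,0))$. 3. Let $E$ be an effect algebra with RDP and let $(H,u)$ be an Abelian unital po-group. Then $E$ is strong $(H,u)$-perfect if and only if $E$ has a strict and retractive ideal $I$ such that $E/I\cong\Gamma(H,u)$. -/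

import Mathlib

universe u v w

/-- An effect algebra `(E; +, 0, 1)`. The partial addition is given by its graph:
`IsSum a b c` means that `a + b` is defined and is equal to `c`. -/
class EffectAlgebra (E : Type u) extends Zero E, One E where
  IsSum : E → E → E → Prop
  /-- The partial addition is single-valued. -/
  sum_unique : ∀ {a b c d : E}, IsSum a b c → IsSum a b d → c = d
  sum_comm : ∀ {a b c : E}, IsSum a b c → IsSum b a c
  sum_assoc : ∀ {a b c e : E},
    (∃ d, IsSum a b d ∧ IsSum d c e) ↔ (∃ f, IsSum b c f ∧ IsSum a f e)
  existsUnique_compl : ∀ a : E, ∃! b : E, IsSum a b 1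
  eq_zero_of_add_one : ∀ {a b : E}, IsSum a 1 b → a = 0

namespace EffectAlgebra

variable {E : Type u} [EffectAlgebra E]

/-- `a ≤ b` iff `a + c = b` for some `c`. -/
def le (a b : E) : Prop := ∃ c, IsSum a c b

/-- The strict part of the order. -/
def lt (a b : E) : Prop := le a b ∧ a ≠ b

/-- The element `a⁻ = 1 - a`. -/
noncomputable def compl (a : E) : E := (existsUnique_compl a).choose

lemma sum_compl (a : E) : IsSum a (compl a) 1 := (existsUnique_compl a).choose_spec.1

lemma eq_compl {a b : E} (h : IsSum a b 1) : b = compl a :=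
  (existsUnique_compl a).choose_spec.2 b h

lemma compl_compl (a : E) : compl (compl a) = a := (eq_compl (sum_comm (sum_compl a))).symm

lemma compl_one : compl (1 : E) = 0 := eq_zero_of_add_one (sum_comm (sum_compl 1))

lemma one_add_zero : IsSum (1 : E) 0 1 := by
  have h := sum_compl (1 : E)
  rwa [compl_one] at h

lemma add_zero (a : E) : IsSum a 0 a := by
  obtain ⟨f, hf, hf'⟩ := sum_assoc.1
    ⟨1, sum_comm (sum_compl a), one_add_zero⟩
  have : f = a := by rw [eq_compl hf', compl_compl]
  rwa [this] at hf

lemma add_left_cancel {a b c d : E} (h : IsSum a b d) (h' : IsSum a c d) : b = c := by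
  obtain ⟨f, hf, hf'⟩ := sum_assoc.1 ⟨d, sum_comm h, sum_compl d⟩
  obtain ⟨g, hg, hg'⟩ := sum_assoc.1 ⟨d, sum_comm h', sum_compl d⟩
  have hfg : f = g := sum_unique hf hg
  subst hfg
  rw [eq_compl (sum_comm hf'), eq_compl (sum_comm hg')]

/-- The Riesz Decomposition Property of an effect algebra. -/
class RDP (E : Type u) [EffectAlgebra E] : Prop where
  decomposition : ∀ {a₁ a₂ b₁ b₂ s : E}, IsSum a₁ a₂ s → IsSum b₁ b₂ s →
    ∃ c₁₁ c₁₂ c₂₁ c₂₂ : E,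
      IsSum c₁₁ c₁₂ a₁ ∧ IsSum c₂₁ c₂₂ a₂ ∧ IsSum c₁₁ c₂₁ b₁ ∧ IsSum c₁₂ c₂₂ b₂

/-- A subset of an effect algebra is directed if it is both upwards and downwards directed. -/
def IsDirectedSet (A : Set E) : Prop :=
  (∀ x ∈ A, ∀ y ∈ A, ∃ z ∈ A, le x z ∧ le y z) ∧ (∀ x ∈ A, ∀ y ∈ A, ∃ z ∈ A, le z x ∧ le z y)

end EffectAlgebra

section Constructions

open EffectAlgebra

/-- Homomorphisms of effect algebras. -/
structure EffectHom (E : Type u) (F : Type v) [EffectAlgebra E] [EffectAlgebra F] where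
  toFun : E → F
  map_one : toFun 1 = 1
  map_add : ∀ {a b c : E}, IsSum a b c → IsSum (toFun a) (toFun b) (toFun c)

/-- Isomorphisms of effect algebras: bijections such that both the map and its inverse are
homomorphisms. -/
structure EffectIso (E : Type u) (F : Type v) [EffectAlgebra E] [EffectAlgebra F]
    extends E ≃ F where
  map_one : toFun 1 = 1
  map_add : ∀ {a b c : E}, IsSum a b c → IsSum (toFun a) (toFun b) (toFun c)
  symm_map_add : ∀ {a b c : F}, IsSum a b c → IsSum (invFun a) (invFun b) (invFun c)

/-- Effect subalgebras. -/
structure EffectSubalgebra (E : Type u) [EffectAlgebra E] where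
  carrier : Set E
  one_mem : 1 ∈ carrier
  compl_mem : ∀ {a : E}, a ∈ carrier → compl a ∈ carrier
  sum_mem : ∀ {a b c : E}, a ∈ carrier → b ∈ carrier → IsSum a b c → c ∈ carrier

namespace EffectSubalgebra

variable {E : Type u} [EffectAlgebra E]

/-- The elements of an effect subalgebra, as a type. -/
def Elem (F : EffectSubalgebra E) : Type u := {x : E // x ∈ F.carrier}

lemma zero_mem (F : EffectSubalgebra E) : (0 : E) ∈ F.carrier := by
  have h := F.compl_mem F.one_mem
  rwa [compl_one] at h

/-- An effect subalgebra is an effect algebra under the restricted addition. -/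
instance (F : EffectSubalgebra E) : EffectAlgebra F.Elem where
  zero := ⟨0, F.zero_mem⟩
  one := ⟨1, F.one_mem⟩
  IsSum a b c := IsSum a.1 b.1 c.1
  sum_unique h h' := Subtype.ext (sum_unique h h')
  sum_comm h := sum_comm h
  sum_assoc := by
    rintro ⟨a, ha⟩ ⟨b, hb⟩ ⟨c, hc⟩ ⟨e, he⟩
    constructor
    · rintro ⟨⟨d, _⟩, h, h'⟩
      obtain ⟨f, hf, hf'⟩ := sum_assoc.1 ⟨d, h, h'⟩
      exact ⟨⟨f, F.sum_mem hb hc hf⟩, hf, hf'⟩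
    · rintro ⟨⟨f, _⟩, h, h'⟩
      obtain ⟨d, hd, hd'⟩ := sum_assoc.2 ⟨f, h, h'⟩
      exact ⟨⟨d, F.sum_mem ha hb hd⟩, hd, hd'⟩
  existsUnique_compl a :=
    ⟨⟨compl a.1, F.compl_mem a.2⟩, sum_compl a.1, fun _ h => Subtype.ext (eq_compl h)⟩
  eq_zero_of_add_one h := Subtype.ext (eq_zero_of_add_one h)

/-- The effect subalgebra `⟨A⟩` generated by a subset `A`: the smallest one containing `A`. -/
def generated (A : Set E) : EffectSubalgebra E where
  carrier := {x | ∀ F : EffectSubalgebra E, A ⊆ F.carrier → x ∈ F.carrier}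
  one_mem := fun F _ => F.one_mem
  compl_mem := fun h F hF => F.compl_mem (h F hF)
  sum_mem := fun ha hb h F hF => F.sum_mem (ha F hF) (hb F hF) h

end EffectSubalgebra

/-- Ideals of an effect algebra. -/
structure EffectIdeal (E : Type u) [EffectAlgebra E] where
  carrier : Set E
  nonempty : carrier.Nonempty
  mem_of_le : ∀ {a b : E}, le a b → b ∈ carrier → a ∈ carrier
  sum_mem : ∀ {a b c : E}, a ∈ carrier → b ∈ carrier → IsSum a b c → c ∈ carrier

namespace EffectIdeal

variable {E : Type u} [EffectAlgebra E]

/-- `a ∼_I b` iff `a - e = b - f` for some `e, f ∈ I` with `e ≤ a` and `f ≤ b`; here `d` is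
the common difference. -/
def rel (I : EffectIdeal E) (a b : E) : Prop :=
  ∃ e ∈ I.carrier, ∃ f ∈ I.carrier, ∃ d, IsSum e d a ∧ IsSum f d b

lemma zero_mem (I : EffectIdeal E) : (0 : E) ∈ I.carrier := by
  obtain ⟨x, hx⟩ := I.nonempty
  exact I.mem_of_le ⟨x, sum_comm (add_zero x)⟩ hx

lemma rel_refl (I : EffectIdeal E) (a : E) : I.rel a a :=
  ⟨0, I.zero_mem, 0, I.zero_mem, a, sum_comm (add_zero a), sum_comm (add_zero a)⟩

lemma rel_symm (I : EffectIdeal E) {a b : E} (h : I.rel a b) : I.rel b a := by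
  obtain ⟨e, he, f, hf, d, h₁, h₂⟩ := h
  exact ⟨f, hf, e, he, d, h₂, h₁⟩

lemma rel_trans [RDP E] (I : EffectIdeal E) {a b c : E} (h : I.rel a b) (h' : I.rel b c) :
    I.rel a c := by
  obtain ⟨e, he, f, hf, d, h₁, h₂⟩ := h
  obtain ⟨f', hf', g, hg, d', h₃, h₄⟩ := h'
  obtain ⟨x, y, z, t, hx, hy, hz, ht⟩ := RDP.decomposition h₂ h₃
  -- `f = x + y`, `d = z + t`, `f' = x + z`, `d' = y + t`
  obtain ⟨p, hp, hp'⟩ := sum_assoc.2 ⟨d, hy, h₁⟩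
  obtain ⟨q, hq, hq'⟩ := sum_assoc.2 ⟨d', ht, h₄⟩
  exact ⟨p, I.sum_mem he (I.mem_of_le ⟨x, sum_comm hz⟩ hf') hp,
    q, I.sum_mem hg (I.mem_of_le ⟨x, sum_comm hx⟩ hf) hq, t, hp', hq'⟩

/-- Under RDP the relation `∼_I` is an equivalence. -/
def setoid [RDP E] (I : EffectIdeal E) : Setoid E :=
  ⟨I.rel, I.rel_refl, I.rel_symm, I.rel_trans⟩

/-- The quotient `E/I`. -/
def Quotient [RDP E] (I : EffectIdeal E) : Type u := _root_.Quotient I.setoid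

/-- The canonical projection `π_I : E → E/I`, `x ↦ x/I`. -/
def proj [RDP E] (I : EffectIdeal E) (x : E) : I.Quotient := Quotient.mk I.setoid x

lemma proj_eq [RDP E] (I : EffectIdeal E) {a b : E} : I.proj a = I.proj b ↔ I.rel a b :=
  ⟨fun h => Quotient.exact (s := I.setoid) h, fun h => Quotient.sound (s := I.setoid) h⟩

lemma proj_surj [RDP E] (I : EffectIdeal E) (q : I.Quotient) : ∃ x, I.proj x = q :=
  Quotient.exists_rep (s := I.setoid) q

lemma rel_add (I : EffectIdeal E) {a a' b b' c c' : E} (ha : I.rel a a') (hb : I.rel b b')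
    (h : IsSum a b c) (h' : IsSum a' b' c') : I.rel c c' := by
  obtain ⟨e, he, f, hf, d, h₁, h₂⟩ := ha
  obtain ⟨e', he', f', hf', d', h₃, h₄⟩ := hb
  -- `c = (e + d) + (e' + d') = (e + e') + (d + d')`, and likewise for `c'`
  have key : ∀ {p q x y z : E}, IsSum p d x → IsSum q d' y → IsSum x y z →
      ∃ m n, IsSum p q m ∧ IsSum d d' n ∧ IsSum m n z := by
    intro p q x y z hx hy hz
    obtain ⟨r, hr, hr'⟩ := sum_assoc.1 ⟨x, hx, hz⟩
    obtain ⟨s, hs, hs'⟩ := sum_assoc.1 ⟨y, hy, sum_comm hr⟩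
    obtain ⟨m, hm, hm'⟩ := sum_assoc.2 ⟨r, hs', hr'⟩
    exact ⟨_, s, hm, sum_comm hs, hm'⟩
  obtain ⟨m, n, hm, hn, hmn⟩ := key h₁ h₃ h
  obtain ⟨m', n', hm', hn', hmn'⟩ := key h₂ h₄ h'
  have : n = n' := sum_unique hn hn'
  subst this
  exact ⟨m, I.sum_mem he he' hm, m', I.sum_mem hf hf' hm', n, hmn, hmn'⟩

lemma rel_compl [RDP E] (I : EffectIdeal E) {a b : E} (h : I.rel a b) :
    I.rel (compl a) (compl b) := by
  obtain ⟨e, he, f, hf, d, h₁, h₂⟩ := h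
  obtain ⟨p, hp, hp'⟩ := sum_assoc.1 ⟨a, sum_comm h₁, sum_compl a⟩
  obtain ⟨q, hq, hq'⟩ := sum_assoc.1 ⟨b, sum_comm h₂, sum_compl b⟩
  have : p = q := add_left_cancel hp' hq'
  subst this
  obtain ⟨x, y, z, t, hx, hy, hz, ht⟩ := RDP.decomposition hp hq
  exact ⟨z, I.mem_of_le ⟨x, sum_comm hz⟩ hf, y, I.mem_of_le ⟨x, sum_comm hx⟩ he, t, hy, ht⟩

/-- `E/I` is an effect algebra: `A + B` is defined and equals `C` iff there are representatives
`a, b, c` of `A, B, C` such that `a + b` is defined and equals `c`. -/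
instance [RDP E] (I : EffectIdeal E) : EffectAlgebra I.Quotient where
  zero := I.proj 0
  one := I.proj 1
  IsSum A B C := ∃ a b c, I.proj a = A ∧ I.proj b = B ∧ I.proj c = C ∧ IsSum a b c
  sum_unique := by
    rintro A B C D ⟨a, b, c, rfl, rfl, rfl, h⟩ ⟨a', b', c', ha, hb, rfl, h'⟩
    exact I.proj_eq.2 (I.rel_add (I.proj_eq.1 ha.symm) (I.proj_eq.1 hb.symm) h h')
  sum_comm := by
    rintro A B C ⟨a, b, c, ha, hb, hc, h⟩
    exact ⟨b, a, c, hb, ha, hc, sum_comm h⟩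
  sum_assoc := by
    have key : ∀ {a b c d d' e : E}, IsSum a b d → I.proj d = I.proj d' → IsSum d' c e →
        ∃ a' b' f e', I.proj a' = I.proj a ∧ I.proj b' = I.proj b ∧ I.proj e' = I.proj e ∧
          IsSum b' c f ∧ IsSum a' f e' := by
      intro a b c d d' e h hd h'
      obtain ⟨i, hi, j, hj, m, h₁, h₂⟩ := I.proj_eq.1 hd
      obtain ⟨x, y, z, t, hx, hy, hz, ht⟩ := RDP.decomposition h h₁
      -- `a = x + y`, `b = z + t`, `i = x + z`, `m = y + t`
      obtain ⟨r, hr, hr'⟩ := sum_assoc.1 ⟨d', h₂, h'⟩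
      obtain ⟨s, hs, hs'⟩ := sum_assoc.1 ⟨m, ht, hr⟩
      have hxI : x ∈ I.carrier := I.mem_of_le ⟨z, hz⟩ hi
      have hzI : z ∈ I.carrier := I.mem_of_le ⟨x, sum_comm hz⟩ hi
      exact ⟨y, t, s, r,
        I.proj_eq.2 ⟨0, I.zero_mem, x, hxI, y, sum_comm (add_zero y), hx⟩,
        I.proj_eq.2 ⟨0, I.zero_mem, z, hzI, t, sum_comm (add_zero t), hy⟩,
        I.proj_eq.2 ⟨0, I.zero_mem, j, hj, r, sum_comm (add_zero r), hr'⟩, hs, hs'⟩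
    intro A B C F
    constructor
    · rintro ⟨D, ⟨a, b, d, rfl, rfl, hd, h⟩, ⟨d', c, e, hd', rfl, rfl, h'⟩⟩
      obtain ⟨a', b', f, e', ha, hb, he, hf, hf'⟩ := key h (hd.trans hd'.symm) h'
      exact ⟨I.proj f, ⟨b', c, f, hb, rfl, rfl, hf⟩, ⟨a', f, e', ha, rfl, he, hf'⟩⟩
    · rintro ⟨D, ⟨b, c, d, rfl, rfl, hd, h⟩, ⟨a, d', e, rfl, hd', rfl, h'⟩⟩
      obtain ⟨c', b', f, e', hc, hb, he, hf, hf'⟩ :=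
        key (sum_comm h) (hd.trans hd'.symm) (sum_comm h')
      exact ⟨I.proj f, ⟨a, b', f, rfl, hb, rfl, sum_comm hf⟩,
        ⟨f, c', e', rfl, hc, he, sum_comm hf'⟩⟩
  existsUnique_compl := by
    intro A
    obtain ⟨a, rfl⟩ := I.proj_surj A
    refine ⟨I.proj (compl a), ⟨a, compl a, 1, rfl, rfl, rfl, sum_compl a⟩, ?_⟩
    rintro B ⟨a', b, c, ha, rfl, hc, h⟩
    -- `c⁻ ∈ I` and `b + c⁻` is the complement of `a'`
    obtain ⟨i, hi, j, hj, m, h₁, h₂⟩ := I.proj_eq.1 hc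
    obtain ⟨n, hn, hn'⟩ := sum_assoc.1 ⟨c, sum_comm h₁, sum_compl c⟩
    have hnj : n = j := add_left_cancel hn' (sum_comm h₂)
    have hcI : compl c ∈ I.carrier := I.mem_of_le ⟨i, sum_comm hn⟩ (hnj ▸ hj)
    obtain ⟨k, hk, hk'⟩ := sum_assoc.1 ⟨c, h, sum_compl c⟩
    have hk'' : k = compl a' := eq_compl hk'
    subst hk''
    have h₃ : I.rel b (compl a') :=
      ⟨0, I.zero_mem, compl c, hcI, b, sum_comm (add_zero b), sum_comm hk⟩
    exact I.proj_eq.2 (I.rel_trans h₃ (I.rel_compl (I.proj_eq.1 ha)))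
  eq_zero_of_add_one := by
    rintro A C ⟨a, b, c, rfl, hb, rfl, h⟩
    obtain ⟨i, hi, j, hj, m, h₁, h₂⟩ := I.proj_eq.1 hb
    -- `1 = m + j` and `1 = m + (i + (a + c⁻))`, hence `a ≤ j`
    obtain ⟨t, ht, ht'⟩ := sum_assoc.1 ⟨c, sum_comm h, sum_compl c⟩
    obtain ⟨r, hr, hr'⟩ := sum_assoc.1 ⟨b, sum_comm h₁, ht'⟩
    have hrj : r = j := add_left_cancel hr' (sum_comm h₂)
    obtain ⟨y, _, hy⟩ := sum_assoc.1 ⟨t, ht, sum_comm hr⟩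
    have haI : a ∈ I.carrier := I.mem_of_le ⟨y, hy⟩ (hrj ▸ hj)
    exact I.proj_eq.2 ⟨a, haI, 0, I.zero_mem, 0, add_zero a, add_zero 0⟩

/-- `I` is strict: `x/I < y/I` implies `x < y`. -/
def IsStrict [RDP E] (I : EffectIdeal E) : Prop :=
  ∀ x y : E, lt (I.proj x) (I.proj y) → lt x y

/-- `I` is retractive: the projection `π_I` has a right inverse which is a homomorphism. -/
def IsRetractive [RDP E] (I : EffectIdeal E) : Prop :=
  ∃ δ : EffectHom I.Quotient E, ∀ q : I.Quotient, I.proj (δ.toFun q) = q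

end EffectIdeal

/-- The Riesz Decomposition Property of an Abelian po-group. -/
def GroupRDP (H : Type u) [AddCommGroup H] [PartialOrder H] : Prop :=
  ∀ a₁ a₂ b₁ b₂ : H, 0 ≤ a₁ → 0 ≤ a₂ → 0 ≤ b₁ → 0 ≤ b₂ → a₁ + a₂ = b₁ + b₂ →
    ∃ c₁₁ c₁₂ c₂₁ c₂₂ : H, 0 ≤ c₁₁ ∧ 0 ≤ c₁₂ ∧ 0 ≤ c₂₁ ∧ 0 ≤ c₂₂ ∧
      a₁ = c₁₁ + c₁₂ ∧ a₂ = c₂₁ + c₂₂ ∧ b₁ = c₁₁ + c₂₁ ∧ b₂ = c₁₂ + c₂₂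

/-- `a` is a strong unit of the po-group `H`. -/
def IsStrongUnit {H : Type u} [AddCommGroup H] [PartialOrder H] (a : H) : Prop :=
  0 ≤ a ∧ ∀ g : H, ∃ n : ℕ, g ≤ n • a

section Interval

variable {H : Type u} [AddCommGroup H] [PartialOrder H]

/-- The interval `Γ(H, a) = {g : 0 ≤ g ≤ a}` for a positive element `a` of a po-group. -/
def Gam (a : H) (_ : 0 ≤ a) : Type u := {g : H // 0 ≤ g ∧ g ≤ a}

/-- `Γ(H, a)` as an effect algebra: the addition is that of `H`, defined whenever the sum
stays below `a`. -/
instance [IsOrderedAddMonoid H] (a : H) (ha : 0 ≤ a) : EffectAlgebra (Gam a ha) where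
  zero := ⟨0, le_rfl, ha⟩
  one := ⟨a, ha, le_rfl⟩
  IsSum x y z := x.1 + y.1 = z.1
  sum_unique h h' := Subtype.ext (h.symm.trans h')
  sum_comm h := (add_comm _ _).trans h
  sum_assoc := by
    rintro ⟨x, hx, hx'⟩ ⟨y, hy, hy'⟩ ⟨z, hz, hz'⟩ ⟨e, he, he'⟩
    constructor
    · rintro ⟨⟨d, hd, hd'⟩, h, h'⟩
      change x + y = d at h
      change d + z = e at h'
      have h₀ : x + (y + z) = e := by rw [← add_assoc, h, h']
      exact ⟨⟨y + z, add_nonneg hy hz, (le_add_of_nonneg_left hx).trans (h₀.le.trans he')⟩,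
        rfl, h₀⟩
    · rintro ⟨⟨d, hd, hd'⟩, h, h'⟩
      change y + z = d at h
      change x + d = e at h'
      have h₀ : (x + y) + z = e := by rw [add_assoc, h, h']
      exact ⟨⟨x + y, add_nonneg hx hy, (le_add_of_nonneg_right hz).trans (h₀.le.trans he')⟩,
        rfl, h₀⟩
  existsUnique_compl := by
    rintro ⟨x, hx, hx'⟩
    refine ⟨⟨a - x, sub_nonneg.2 hx', sub_le_self a hx⟩, add_sub_cancel x a, ?_⟩
    rintro ⟨y, hy, hy'⟩ h
    exact Subtype.ext (eq_sub_of_add_eq' h)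
  eq_zero_of_add_one := by
    rintro ⟨x, hx, hx'⟩ ⟨z, hz, hz'⟩ h
    change x + a = z at h
    exact Subtype.ext (le_antisymm (show x ≤ 0 by simpa using h.le.trans hz') hx)

end Interval

section Lexicographic

variable {H : Type u} [AddCommGroup H] [PartialOrder H]

/-- The element `(a, 0)` of the lexicographic product of `H` and `G`. -/
def lexUnit (G : Type v) [AddCommGroup G] (a : H) : H ×ₗ G := toLex (a, 0)

lemma lexUnit_nonneg (G : Type v) [AddCommGroup G] [PartialOrder G] {a : H} (ha : 0 ≤ a) :
    0 ≤ lexUnit G a := by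
  refine Prod.Lex.le_iff.2 ?_
  rcases ha.lt_or_eq with h | h
  · exact Or.inl h
  · exact Or.inr ⟨h, le_rfl⟩

end Lexicographic

section Perfect

variable {E : Type v} [EffectAlgebra E] {H : Type u} [AddCommGroup H] [PartialOrder H]

/-- `(D t : t ∈ [0, a])` is an `(H, a)`-decomposition of `E`. Values of `D` outside the interval
`[0, a]` are irrelevant. -/
structure IsDecomposition (a : H) (D : H → Set E) : Prop where
  nonempty : ∀ t ∈ Set.Icc 0 a, (D t).Nonempty
  disjoint : ∀ s ∈ Set.Icc 0 a, ∀ t ∈ Set.Icc 0 a, s ≠ t → D s ∩ D t = ∅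
  cover : ∀ x : E, ∃ t ∈ Set.Icc 0 a, x ∈ D t
  compl_eq : ∀ t ∈ Set.Icc 0 a, EffectAlgebra.compl '' D t = D (a - t)
  sum_mem : ∀ s ∈ Set.Icc 0 a, ∀ t ∈ Set.Icc 0 a, ∀ x ∈ D s, ∀ y ∈ D t, ∀ z : E,
    IsSum x y z → s + t ≤ a ∧ z ∈ D (s + t)

/-- `E` is strong `(H, a)`-perfect: it has an ordered and directed `(H, a)`-decomposition
`(D t)` with a system of elements `c t ∈ D t` such that `c v + c t = c (v + t)` whenever
`v + t ≤ a`, and `c a = 1`. -/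
def IsStrongPerfect (E : Type v) [EffectAlgebra E] (a : H) : Prop :=
  ∃ D : H → Set E, IsDecomposition a D ∧
    (∀ s ∈ Set.Icc 0 a, ∀ t ∈ Set.Icc 0 a, s < t → ∀ x ∈ D s, ∀ y ∈ D t, le x y) ∧
    (∀ t ∈ Set.Icc 0 a, IsDirectedSet (D t)) ∧
    ∃ c : H → E, (∀ t ∈ Set.Icc 0 a, c t ∈ D t) ∧
      (∀ s ∈ Set.Icc 0 a, ∀ t ∈ Set.Icc 0 a, s + t ≤ a → IsSum (c s) (c t) (c (s + t))) ∧
      c a = 1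

end Perfect

end Constructions

open EffectAlgebra

/-! Three constructions carry the theorem.

Coordinatization. An effect algebra `F` with RDP is an interval of a unital po-group. Let
`UniversalMonoid F` be the commutative monoid generated by `F` subject to its defined sums.
Evaluating formal sums as far as they are defined (`value`) shows that `F` embeds as a lower set in
which a sum is defined exactly when it stays inside `F`. By RDP the splittings of a generator depend
additively on it, so they extend to an additive map on the monoid; this yields refinement, and
refinement yields cancellation. The monoid is therefore the positive cone of a group with RDP.
Applied to `E/I`, which inherits RDP, it produces `(H, u)`.

Representation (`EffectIdeal.exists_lex_iso`). Strictness puts `I` below every element outside `I`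
and lets elements of `I` be added to everything outside the top coset. For `I ≠ E` the addition of
`I` is thus total, and `I` is the positive cone of a directed group `G`. If `δ` is the retraction,
then `x` and `δ(x/I)` lie in one coset and differ by an element of `G`, the offset of `x`. The map
sending `x` to the pair of `x/I` and this offset is the isomorphism with the lexicographic interval.

Decompositions. In a lexicographic interval the levels of the first coordinate form an ordered
directed decomposition with `c t = (t, 0)`. In any such decomposition `D 0` is an ideal whose
quotient is read off from the index; the order of the levels gives strictness and `c` gives the
retraction. Conversely, the cosets of a strict retractive ideal form such a decomposition. In the
lexicographic case `⟨I⟩` consists of the bottom and top levels, which is an interval over `ℤ`. -/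

/-! ### Positive cones from cancellative monoids, and isomorphisms -/

/-- A commutative monoid has refinement if any two decompositions of an element into two summands
have a common refinement. -/
def HasRefinement (M : Type u) [AddCommMonoid M] : Prop :=
  ∀ a₁ a₂ b₁ b₂ : M, a₁ + a₂ = b₁ + b₂ → ∃ c₁₁ c₁₂ c₂₁ c₂₂ : M,
    a₁ = c₁₁ + c₁₂ ∧ a₂ = c₂₁ + c₂₂ ∧ b₁ = c₁₁ + c₂₁ ∧ b₂ = c₁₂ + c₂₂

/-- A cancellative conical commutative monoid is the positive cone of a po-group which it
generates. -/
theorem exists_orderedGroup_of_conical (M : Type u) [AddCancelCommMonoid M]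
    (hM : ∀ a b : M, a + b = 0 → a = 0) :
    ∃ (G : Type u) (_ : AddCommGroup G) (_ : PartialOrder G) (_ : IsOrderedAddMonoid G)
      (ι : M →+ G), Function.Injective ι ∧ (∀ g, 0 ≤ g ↔ ∃ m, ι m = g) ∧
        ∀ g, ∃ m n, g = ι m - ι n := by
  let G := Algebra.GrothendieckAddGroup M
  let ι : M →+ G := Algebra.GrothendieckAddGroup.of
  have hι : Function.Injective ι := Algebra.GrothendieckAddGroup.of_injective
  -- Conicality is what makes the image of `M` meet its negative only in `0`, so that the induced
  -- preorder is antisymmetric.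
  let C : AddGroupCone G :=
    { AddMonoidHom.mrange ι with
      eq_zero_of_mem_of_neg_mem' := by
        rintro _ ⟨m, rfl⟩ ⟨n, hn⟩
        have h : ι (m + n) = ι 0 := by rw [map_add, hn, add_neg_cancel, map_zero]
        rw [hM m n (hι h), map_zero] }
  let _ : PartialOrder G := PartialOrder.mkOfAddGroupCone C
  refine ⟨G, inferInstance, inferInstance, IsOrderedAddMonoid.mkOfCone C, ι, hι, fun g => ?_,
    fun g => ?_⟩
  · change g - 0 ∈ C ↔ _
    rw [sub_zero]
    rfl
  · induction g using AddLocalization.ind with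
    | _ y =>
      refine ⟨y.1, y.2, eq_sub_of_add_eq ?_⟩
      have := (AddLocalization.addMonoidOf (⊤ : AddSubmonoid M)).mk'_spec y.1 y.2
      rwa [← AddLocalization.mk_eq_addMonoidOf_mk'] at this

theorem HasRefinement.groupRDP {M : Type u} [AddCommMonoid M] (hM : HasRefinement M)
    {G : Type v} [AddCommGroup G] [PartialOrder G] {ι : M →+ G} (hι : Function.Injective ι)
    (hpos : ∀ g, 0 ≤ g ↔ ∃ m, ι m = g) : GroupRDP G := by
  intro a₁ a₂ b₁ b₂ h₁ h₂ h₃ h₄ h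
  obtain ⟨a₁, rfl⟩ := (hpos _).1 h₁
  obtain ⟨a₂, rfl⟩ := (hpos _).1 h₂
  obtain ⟨b₁, rfl⟩ := (hpos _).1 h₃
  obtain ⟨b₂, rfl⟩ := (hpos _).1 h₄
  rw [← map_add, ← map_add] at h
  obtain ⟨c₁₁, c₁₂, c₂₁, c₂₂, rfl, rfl, rfl, rfl⟩ := hM _ _ _ _ (hι h)
  exact ⟨ι c₁₁, ι c₁₂, ι c₂₁, ι c₂₂, (hpos _).2 ⟨_, rfl⟩, (hpos _).2 ⟨_, rfl⟩,
    (hpos _).2 ⟨_, rfl⟩, (hpos _).2 ⟨_, rfl⟩, map_add .., map_add .., map_add .., map_add ..⟩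

/-- A bijection that preserves and reflects sums and preserves `1` is an isomorphism. -/
noncomputable def EffectIso.ofBijective {E : Type u} {F : Type v} [EffectAlgebra E]
    [EffectAlgebra F] (f : E → F) (hf : Function.Bijective f) (h1 : f 1 = 1)
    (hsum : ∀ a b c : E, IsSum a b c ↔ IsSum (f a) (f b) (f c)) : EffectIso E F where
  toEquiv := Equiv.ofBijective f hf
  map_one := h1
  map_add := (hsum _ _ _).1
  symm_map_add {a b c} h := by
    have key := Equiv.ofBijective_apply_symm_apply f hf
    refine (hsum _ _ _).2 ?_
    change IsSum (f ((Equiv.ofBijective f hf).symm a)) (f ((Equiv.ofBijective f hf).symm b))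
      (f ((Equiv.ofBijective f hf).symm c))
    rwa [key, key, key]

theorem EffectIso.isSum_iff {E : Type u} {F : Type v} [EffectAlgebra E] [EffectAlgebra F]
    (φ : EffectIso E F) {a b c : E} : IsSum a b c ↔ IsSum (φ.toFun a) (φ.toFun b) (φ.toFun c) := by
  refine ⟨φ.map_add, fun h => ?_⟩
  have key := φ.left_inv
  have := φ.symm_map_add h
  rwa [key, key, key] at this

lemma EffectAlgebra.eq_zero_of_isSum_zero {E : Type u} [EffectAlgebra E] {a b : E}
    (h : IsSum a b 0) : a = 0 := by
  obtain ⟨f, hf, -⟩ := sum_assoc.1 ⟨0, h, EffectAlgebra.sum_comm one_add_zero⟩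
  rw [eq_zero_of_add_one hf] at h
  exact EffectAlgebra.sum_unique (EffectAlgebra.add_zero a) h

/-! ### The universal monoid of an effect algebra -/

section UniversalMonoid

/-- Sets of elements of an effect algebra, added elementwise as far as the sums are defined. -/
def ValueSet (F : Type u) : Type u := Set F

/-- The set with a single element. -/
def ValueSet.single {F : Type u} (a : F) : ValueSet F := ({a} : Set F)

instance (F : Type u) : Membership F (ValueSet F) := inferInstanceAs (Membership F (Set F))

lemma ValueSet.ext {F : Type u} {A B : ValueSet F} (h : ∀ x, x ∈ A ↔ x ∈ B) : A = B :=
  Set.ext h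

instance (F : Type u) [EffectAlgebra F] : Zero (ValueSet F) := ⟨.single 0⟩

instance (F : Type u) [EffectAlgebra F] : Add (ValueSet F) :=
  ⟨fun A B => {c : F | ∃ a ∈ A, ∃ b ∈ B, IsSum a b c}⟩

/-- With the empty set standing for an undefined sum, the partial addition becomes total, so the
universal property can be used to evaluate formal sums in `F`. -/
instance (F : Type u) [EffectAlgebra F] : AddCommMonoid (ValueSet F) where
  add_assoc A B C := by
    refine ValueSet.ext fun e => ⟨?_, ?_⟩
    · rintro ⟨d, ⟨a, ha, b, hb, h⟩, c, hc, h'⟩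
      obtain ⟨f, hf, hf'⟩ := sum_assoc.1 ⟨d, h, h'⟩
      exact ⟨a, ha, f, ⟨b, hb, c, hc, hf⟩, hf'⟩
    · rintro ⟨a, ha, d, ⟨b, hb, c, hc, h⟩, h'⟩
      obtain ⟨f, hf, hf'⟩ := sum_assoc.2 ⟨d, h, h'⟩
      exact ⟨f, ⟨a, ha, b, hb, hf⟩, c, hc, hf'⟩
  add_comm A B := ValueSet.ext fun e =>
    ⟨fun ⟨a, ha, b, hb, h⟩ => ⟨b, hb, a, ha, EffectAlgebra.sum_comm h⟩,
      fun ⟨a, ha, b, hb, h⟩ => ⟨b, hb, a, ha, EffectAlgebra.sum_comm h⟩⟩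
  zero_add A := by
    refine ValueSet.ext fun e => ⟨?_, fun he => ⟨0, rfl, e, he, EffectAlgebra.sum_comm (add_zero e)⟩⟩
    rintro ⟨_, rfl, b, hb, h⟩
    rwa [EffectAlgebra.sum_unique h (EffectAlgebra.sum_comm (add_zero b))]
  add_zero A := by
    refine ValueSet.ext fun e => ⟨?_, fun he => ⟨e, he, 0, rfl, EffectAlgebra.add_zero e⟩⟩
    rintro ⟨b, hb, _, rfl, h⟩
    rwa [EffectAlgebra.sum_unique h (EffectAlgebra.add_zero b)]
  nsmul := nsmulRec

variable (F : Type u) [EffectAlgebra F]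

/-- The defining relations of the universal monoid of an effect algebra. -/
inductive UniversalMonoid.Rel : Multiset F → Multiset F → Prop
  | zero : UniversalMonoid.Rel {0} 0
  | sum {a b c : F} : IsSum a b c → UniversalMonoid.Rel {c} ({a} + {b})

/-- The commutative monoid freely generated by an effect algebra subject to its defined sums. -/
def UniversalMonoid : Type u := (addConGen (UniversalMonoid.Rel F)).Quotient

namespace UniversalMonoid

instance : AddCommMonoid (UniversalMonoid F) :=
  inferInstanceAs (AddCommMonoid (addConGen (UniversalMonoid.Rel F)).Quotient)

variable {F}

/-- The quotient map from the multisets. -/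
def mk : Multiset F →+ UniversalMonoid F := (addConGen (UniversalMonoid.Rel F)).mk'

/-- The canonical map of an effect algebra into its universal monoid. -/
def of (a : F) : UniversalMonoid F := mk {a}

lemma of_zero : of (0 : F) = 0 :=
  (AddCon.eq _).2 (AddConGen.Rel.of _ _ Rel.zero)

lemma of_sum {a b c : F} (h : IsSum a b c) : of c = of a + of b :=
  (AddCon.eq _).2 (AddConGen.Rel.of _ _ (Rel.sum h))

lemma induction {p : UniversalMonoid F → Prop} (h0 : p 0) (h : ∀ a m, p m → p (of a + m))
    (m : UniversalMonoid F) : p m := by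
  obtain ⟨A, rfl⟩ := AddCon.mk'_surjective m
  change p (mk A)
  induction A using Multiset.induction with
  | empty => simpa using h0
  | cons a A ih =>
    rw [← Multiset.singleton_add, map_add]
    exact h a _ ih

/-- The universal property of the universal monoid. -/
def lift {N : Type v} [AddCommMonoid N] (f : F → N) (h0 : f 0 = 0)
    (h : ∀ a b c : F, IsSum a b c → f c = f a + f b) : UniversalMonoid F →+ N :=
  AddCon.lift _ (Multiset.sumAddMonoidHom.comp (Multiset.mapAddMonoidHom f)) <|
    AddCon.addConGen_le.2 <| by
      rintro _ _ (_ | hs)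
      · simpa [AddCon.ker_rel] using h0
      · simpa [AddCon.ker_rel] using h _ _ _ hs

lemma lift_of {N : Type v} [AddCommMonoid N] (f : F → N) (h0 : f 0 = 0)
    (h : ∀ a b c : F, IsSum a b c → f c = f a + f b) (a : F) : lift f h0 h (of a) = f a := by
  change (Multiset.map f {a}).sum = f a
  simp

/-- The value of a formal sum in the effect algebra, if there is one. -/
def value : UniversalMonoid F →+ ValueSet F :=
  lift ValueSet.single rfl fun a b c h => ValueSet.ext fun d => by
    constructor
    · rintro rfl
      exact ⟨a, rfl, b, rfl, h⟩
    · rintro ⟨_, rfl, _, rfl, h'⟩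
      exact EffectAlgebra.sum_unique h' h

lemma mem_value_of {a b : F} : b ∈ value (of a) ↔ b = a := by
  rw [value, lift_of]
  rfl

lemma mem_value_add {m n : UniversalMonoid F} {c : F} : c ∈ value (m + n) ↔
    ∃ a ∈ value m, ∃ b ∈ value n, IsSum a b c := by
  rw [map_add]
  rfl

/-- Peeling off one generator at a time, each partial sum that has a value may be replaced by the
generator of that value. -/
lemma eq_of_mem_value {m : UniversalMonoid F} : ∀ {a : F}, a ∈ value m → m = of a := by
  induction m using induction with
  | h0 =>
    intro a ha
    rw [map_zero] at ha
    rw [show a = 0 from ha, of_zero]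
  | h b m ih =>
    intro a ha
    obtain ⟨b', hb', c, hc, h⟩ := mem_value_add.1 ha
    rw [mem_value_of.1 hb'] at h
    rw [ih hc, of_sum h]

lemma of_injective : Function.Injective (of : F → UniversalMonoid F) := fun _ _ h =>
  mem_value_of.1 (h ▸ mem_value_of.2 rfl)

/-- The image of `F` is a lower set: the value `c` of `m + n` must arise from a value of `m` and a
value of `n`, and these determine `m` and `n`. -/
lemma exists_of_add_eq {m n : UniversalMonoid F} {c : F} (h : m + n = of c) :
    ∃ a b, m = of a ∧ n = of b ∧ IsSum a b c := by
  have hc : c ∈ value (m + n) := h ▸ mem_value_of.2 rfl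
  obtain ⟨a, ha, b, hb, hs⟩ := mem_value_add.1 hc
  exact ⟨a, b, eq_of_mem_value ha, eq_of_mem_value hb, hs⟩

lemma isSum_iff {a b c : F} : IsSum a b c ↔ of a + of b = of c := by
  refine ⟨fun h => (of_sum h).symm, fun h => ?_⟩
  obtain ⟨a', b', ha, hb, hs⟩ := exists_of_add_eq h
  rwa [of_injective ha, of_injective hb]

lemma eq_zero_of_add_eq_zero {m n : UniversalMonoid F} (h : m + n = 0) : m = 0 := by
  rw [← of_zero] at h
  obtain ⟨a, b, rfl, -, hs⟩ := exists_of_add_eq h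
  rw [EffectAlgebra.eq_zero_of_isSum_zero hs, of_zero]

/-! ### Refinement and cancellation under RDP -/

section Refinement

variable [RDP F]

open scoped Pointwise

/-- The splittings of a formal sum that come from splittings of its terms. -/
def splittings : UniversalMonoid F →+ Set (UniversalMonoid F × UniversalMonoid F) :=
  lift (fun a => {p | ∃ b c, IsSum b c a ∧ p = (of b, of c)})
    (by
      ext p
      rw [Set.mem_zero]
      constructor
      · rintro ⟨b, c, h, rfl⟩
        have h' := of_sum h
        rw [of_zero] at h'
        rw [eq_zero_of_add_eq_zero h'.symm, eq_zero_of_add_eq_zero ((add_comm _ _).trans h'.symm)]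
        rfl
      · rintro rfl
        exact ⟨0, 0, EffectAlgebra.add_zero 0, by rw [of_zero]; rfl⟩)
    (by
      intro a b c h
      ext p
      rw [Set.mem_add]
      constructor
      · rintro ⟨x, y, hxy, rfl⟩
        -- RDP says exactly that every splitting of `c = a + b` is a splitting of `a` plus a
        -- splitting of `b`. The other inclusion needs no RDP: the recombined parts are generators
        -- because they sum to one.
        obtain ⟨p, q, r, s, h₁, h₂, h₃, h₄⟩ := RDP.decomposition h hxy
        exact ⟨_, ⟨p, q, h₁, rfl⟩, _, ⟨r, s, h₂, rfl⟩, by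
          rw [of_sum h₃, of_sum h₄]; rfl⟩
      · rintro ⟨_, ⟨p, q, h₁, rfl⟩, _, ⟨r, s, h₂, rfl⟩, rfl⟩
        have h' : (of p + of r) + (of q + of s) = of c := by
          rw [of_sum h, of_sum h₁, of_sum h₂, add_add_add_comm]
        obtain ⟨x, y, hx, hy, hs⟩ := exists_of_add_eq h'
        exact ⟨x, y, hs, by rw [← hx, ← hy]; rfl⟩)

lemma mem_splittings_of {a : F} {p : UniversalMonoid F × UniversalMonoid F} :
    p ∈ splittings (of a) ↔ ∃ b c, IsSum b c a ∧ p = (of b, of c) := by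
  rw [splittings, lift_of]
  rfl

lemma add_eq_of_mem_splittings {m : UniversalMonoid F} :
    ∀ {p : UniversalMonoid F × UniversalMonoid F}, p ∈ splittings m → p.1 + p.2 = m := by
  induction m using induction with
  | h0 =>
    intro p hp
    rw [map_zero, Set.mem_zero] at hp
    simp [hp]
  | h b m ih =>
    intro p hp
    rw [map_add, Set.mem_add] at hp
    obtain ⟨q, hq, r, hr, rfl⟩ := hp
    obtain ⟨x, y, hs, rfl⟩ := mem_splittings_of.1 hq
    rw [← ih hr, of_sum hs]
    exact add_add_add_comm _ _ _ _

lemma left_mem_splittings (m : UniversalMonoid F) : (m, 0) ∈ splittings m := by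
  induction m using induction with
  | h0 => rw [map_zero]; rfl
  | h b m ih =>
    rw [map_add]
    exact ⟨(of b, 0), mem_splittings_of.2 ⟨b, 0, EffectAlgebra.add_zero b, by rw [of_zero]⟩,
      _, ih, by simp⟩

lemma right_mem_splittings (m : UniversalMonoid F) : (0, m) ∈ splittings m := by
  induction m using induction with
  | h0 => rw [map_zero]; rfl
  | h b m ih =>
    rw [map_add]
    exact ⟨(0, of b), mem_splittings_of.2 ⟨0, b, EffectAlgebra.sum_comm (EffectAlgebra.add_zero b),
      by rw [of_zero]⟩, _, ih, by simp⟩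

-- The pair `(b₁, b₂)` splits `b₁ + b₂ = a₁ + a₂`. By additivity of `splittings` it is a splitting
-- of `a₁` plus a splitting of `a₂`, and these are the rows of the refinement.
variable (F) in
theorem hasRefinement : HasRefinement (UniversalMonoid F) := by
  intro a₁ a₂ b₁ b₂ h
  have hb : (b₁, b₂) ∈ splittings (b₁ + b₂) := by
    rw [map_add]
    exact ⟨_, left_mem_splittings b₁, _, right_mem_splittings b₂, by simp⟩
  rw [← h, map_add] at hb
  obtain ⟨p, hp, q, hq, hpq⟩ := hb
  exact ⟨p.1, p.2, q.1, q.2, (add_eq_of_mem_splittings hp).symm,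
    (add_eq_of_mem_splittings hq).symm, (congrArg Prod.fst hpq).symm, (congrArg Prod.snd hpq).symm⟩

/-- Refine the two decompositions. The first row and the first column both sum to `of a`, so their
entries are generators, and cancellation in `F` identifies the two off-diagonal entries. Hence `x`
and `y` have equal summands. -/
lemma add_left_cancel_of {x y : UniversalMonoid F} {a : F} (h : of a + x = of a + y) : x = y := by
  obtain ⟨p, q, r, s, h₁, rfl, h₃, rfl⟩ := hasRefinement F _ _ _ _ h
  obtain ⟨p', q', rfl, rfl, hs⟩ := exists_of_add_eq h₁.symm
  obtain ⟨p'', r', hp, rfl, hs'⟩ := exists_of_add_eq h₃.symm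
  rw [← of_injective hp] at hs'
  rw [EffectAlgebra.add_left_cancel hs hs']

instance : AddCancelCommMonoid (UniversalMonoid F) where
  add_left_cancel z := by
    induction z using induction with
    | h0 => intro x y h; simpa using h
    | h a m ih =>
      intro x y h
      change of a + m + x = of a + m + y at h
      rw [add_assoc, add_assoc] at h
      exact ih (add_left_cancel_of h)

end Refinement

end UniversalMonoid

/-- An effect algebra with RDP is an interval in a unital po-group with RDP. -/
theorem exists_unitalGroup [RDP F] :
    ∃ (H : Type u) (_ : AddCommGroup H) (_ : PartialOrder H) (_ : IsOrderedAddMonoid H)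
      (a : H) (ha : IsStrongUnit a), GroupRDP H ∧ Nonempty (EffectIso F (Gam a ha.1)) := by
  obtain ⟨H, i₁, i₂, i₃, ι, hι, hpos, hgen⟩ := exists_orderedGroup_of_conical (UniversalMonoid F)
    fun _ _ => UniversalMonoid.eq_zero_of_add_eq_zero
  have hle : ∀ {m n}, m + n = UniversalMonoid.of (1 : F) → ι m ≤ ι (UniversalMonoid.of 1) := by
    intro m n h
    rw [← h, map_add]
    exact le_add_of_nonneg_right ((hpos _).2 ⟨n, rfl⟩)
  have hle' : ∀ x : F, ι (UniversalMonoid.of x) ≤ ι (UniversalMonoid.of 1) := fun x =>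
    hle (UniversalMonoid.of_sum (sum_compl x)).symm
  have hunit : IsStrongUnit (ι (UniversalMonoid.of 1)) := by
    refine ⟨(hpos _).2 ⟨_, rfl⟩, fun g => ?_⟩
    obtain ⟨m, n, rfl⟩ := hgen g
    have hm : ∃ k : ℕ, ι m ≤ k • ι (UniversalMonoid.of 1) := by
      induction m using UniversalMonoid.induction with
      | h0 => exact ⟨0, by simp⟩
      | h a m ih =>
        obtain ⟨k, hk⟩ := ih
        exact ⟨k + 1, by rw [map_add, succ_nsmul']; exact add_le_add (hle' a) hk⟩
    obtain ⟨k, hk⟩ := hm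
    exact ⟨k, (sub_le_self _ ((hpos _).2 ⟨n, rfl⟩)).trans hk⟩
  refine ⟨H, i₁, i₂, i₃, _, hunit, (UniversalMonoid.hasRefinement F).groupRDP hι hpos,
    ⟨EffectIso.ofBijective
      (fun x => ⟨ι (UniversalMonoid.of x), (hpos _).2 ⟨_, rfl⟩, hle' x⟩) ⟨?_, ?_⟩ rfl ?_⟩⟩
  · intro x y h
    exact UniversalMonoid.of_injective (hι (congrArg Subtype.val h))
  · rintro ⟨g, hg, hg'⟩
    obtain ⟨m, rfl⟩ := (hpos _).1 hg
    -- The complement of `g` in the unit is also in the cone, so `g` comes from a summand of `of 1`,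
    -- and such summands lie in `F`.
    obtain ⟨n, hn⟩ := (hpos _).1 (sub_nonneg.2 hg')
    have h : m + n = UniversalMonoid.of 1 := hι (by rw [map_add, hn, add_sub_cancel])
    obtain ⟨x, y, rfl, -, -⟩ := UniversalMonoid.exists_of_add_eq h
    exact ⟨x, rfl⟩
  · intro x y z
    rw [UniversalMonoid.isSum_iff, ← hι.eq_iff, map_add]
    rfl

end UniversalMonoid

/-! ### From a strong perfect decomposition to a strict retractive ideal -/

section Decomposition

variable {E : Type u} [EffectAlgebra E] {H : Type v} [AddCommGroup H] [PartialOrder H]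
  {a : H} {D : H → Set E}

namespace IsDecomposition

/-- The index of the class of a decomposition that contains `x`. -/
noncomputable def index (hD : IsDecomposition a D) (x : E) : H :=
  (hD.cover x).choose

lemma index_mem (hD : IsDecomposition a D) (x : E) : hD.index x ∈ Set.Icc 0 a :=
  (hD.cover x).choose_spec.1

lemma mem_index (hD : IsDecomposition a D) (x : E) : x ∈ D (hD.index x) :=
  (hD.cover x).choose_spec.2

lemma nonneg (hD : IsDecomposition a D) : 0 ≤ a := (hD.index_mem 0).1.trans (hD.index_mem 0).2

lemma mem_iff (hD : IsDecomposition a D) {x : E} {t : H} (ht : t ∈ Set.Icc 0 a) :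
    x ∈ D t ↔ hD.index x = t := by
  refine ⟨fun hx => ?_, fun h => h ▸ hD.mem_index x⟩
  by_contra hne
  have := hD.disjoint _ (hD.index_mem x) _ ht hne
  exact (this ▸ ⟨hD.mem_index x, hx⟩ : x ∈ (∅ : Set E))

lemma mem_zero_iff (hD : IsDecomposition a D) {x : E} : x ∈ D 0 ↔ hD.index x = 0 :=
  hD.mem_iff ⟨le_rfl, hD.nonneg⟩

variable [IsOrderedAddMonoid H]

lemma index_add (hD : IsDecomposition a D) {x y z : E} (h : IsSum x y z) :
    hD.index x + hD.index y = hD.index z := by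
  obtain ⟨h₁, h₂⟩ := hD.sum_mem _ (hD.index_mem x) _ (hD.index_mem y) _ (hD.mem_index x) _
    (hD.mem_index y) _ h
  exact ((hD.mem_iff ⟨add_nonneg (hD.index_mem x).1 (hD.index_mem y).1, h₁⟩).1 h₂).symm

/-- The class with index `0` of a decomposition, as an ideal. -/
def ideal (hD : IsDecomposition a D) : EffectIdeal E where
  carrier := D 0
  nonempty := hD.nonempty 0 ⟨le_rfl, hD.nonneg⟩
  mem_of_le := by
    rintro x y ⟨c, hc⟩ hy
    rw [hD.mem_zero_iff] at hy ⊢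
    have h := hD.index_add hc
    rw [hy] at h
    exact le_antisymm ((le_add_of_nonneg_right (hD.index_mem c).1).trans h.le) (hD.index_mem x).1
  sum_mem := by
    intro x y z hx hy h
    rw [hD.mem_zero_iff] at hx hy ⊢
    rw [← hD.index_add h, hx, hy, _root_.add_zero]

/-- Two elements of one level have a common lower bound in that level, and their differences from it
have index `0`. This is where downward directedness enters. -/
lemma rel_iff (hD : IsDecomposition a D) (hdir : ∀ t ∈ Set.Icc 0 a, IsDirectedSet (D t))
    {x y : E} : hD.ideal.rel x y ↔ hD.index x = hD.index y := by
  constructor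
  · rintro ⟨e, he, f, hf, d, h, h'⟩
    rw [← hD.index_add h, ← hD.index_add h', hD.mem_zero_iff.1 he, hD.mem_zero_iff.1 hf]
  · intro hxy
    obtain ⟨d, hd, ⟨e, he⟩, ⟨f, hf⟩⟩ := (hdir _ (hD.index_mem x)).2 x (hD.mem_index x) y
      (hxy ▸ hD.mem_index y)
    rw [hD.mem_iff (hD.index_mem x)] at hd
    refine ⟨e, hD.mem_zero_iff.2 ?_, f, hD.mem_zero_iff.2 ?_, d, EffectAlgebra.sum_comm he,
      EffectAlgebra.sum_comm hf⟩
    · simpa [hd] using hD.index_add he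
    · simpa [hd, ← hxy] using hD.index_add hf

theorem exists_strict_retractive [RDP E] (hD : IsDecomposition a D)
    (hord : ∀ s ∈ Set.Icc 0 a, ∀ t ∈ Set.Icc 0 a, s < t → ∀ x ∈ D s, ∀ y ∈ D t, le x y)
    (hdir : ∀ t ∈ Set.Icc 0 a, IsDirectedSet (D t)) {c : H → E}
    (hc : ∀ t ∈ Set.Icc 0 a, c t ∈ D t)
    (hcadd : ∀ s ∈ Set.Icc 0 a, ∀ t ∈ Set.Icc 0 a, s + t ≤ a → IsSum (c s) (c t) (c (s + t)))
    (hc1 : c a = 1) :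
    hD.ideal.IsStrict ∧ hD.ideal.IsRetractive ∧
      Nonempty (EffectIso hD.ideal.Quotient (Gam a hD.nonneg)) := by
  have hproj : ∀ x y, hD.ideal.proj x = hD.ideal.proj y ↔ hD.index x = hD.index y := fun x y =>
    hD.ideal.proj_eq.trans (hD.rel_iff hdir)
  have hindex : ∀ t ∈ Set.Icc 0 a, hD.index (c t) = t := fun t ht => (hD.mem_iff ht).1 (hc t ht)
  let f : hD.ideal.Quotient → Gam a hD.nonneg := Quotient.lift (s := hD.ideal.setoid)
    (fun x => ⟨hD.index x, hD.index_mem x⟩) fun x y h => Subtype.ext ((hD.rel_iff hdir).1 h)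
  have hf : ∀ x, (f (hD.ideal.proj x)).1 = hD.index x := fun _ => rfl
  have hsum : ∀ A B C, IsSum A B C ↔ IsSum (f A) (f B) (f C) := by
    intro A B C
    constructor
    · rintro ⟨x, y, z, rfl, rfl, rfl, h⟩
      exact hD.index_add h
    · intro h
      obtain ⟨x, rfl⟩ := hD.ideal.proj_surj A
      obtain ⟨y, rfl⟩ := hD.ideal.proj_surj B
      obtain ⟨z, rfl⟩ := hD.ideal.proj_surj C
      replace h : hD.index x + hD.index y = hD.index z := h
      -- The sum of `x` and `y` need not be defined, but the sum of the representatives `c` of their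
      -- classes is.
      refine ⟨c (hD.index x), c (hD.index y), c (hD.index z), (hproj _ _).2 ?_, (hproj _ _).2 ?_,
        (hproj _ _).2 ?_, h ▸ hcadd _ (hD.index_mem x) _ (hD.index_mem y) ?_⟩
      · exact hindex _ (hD.index_mem x)
      · exact hindex _ (hD.index_mem y)
      · exact hindex _ (hD.index_mem z)
      · rw [h]
        exact (hD.index_mem z).2
  have hone : f 1 = 1 := by
    refine Subtype.ext ?_
    change hD.index 1 = a
    rw [← hc1, hindex a ⟨hD.nonneg, le_rfl⟩]
  refine ⟨?_, ⟨⟨fun q => c (f q).1, ?_, ?_⟩, ?_⟩, ⟨EffectIso.ofBijective f ⟨?_, ?_⟩ hone hsum⟩⟩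
  · rintro x y ⟨⟨C, hC⟩, hne⟩
    have hle : hD.index x ≤ hD.index y := by
      have h : hD.index x + (f C).1 = hD.index y := (hsum _ _ _).1 hC
      rw [← h]
      exact le_add_of_nonneg_right (f C).2.1
    have hne' : hD.index x ≠ hD.index y := fun h => hne ((hproj _ _).2 h)
    exact ⟨hord _ (hD.index_mem x) _ (hD.index_mem y) (hle.lt_of_ne hne') _ (hD.mem_index x) _
      (hD.mem_index y), fun h => hne' (congrArg _ h)⟩
  · rw [hone]
    exact hc1
  · intro A B C h
    have h' : (f A).1 + (f B).1 = (f C).1 := (hsum _ _ _).1 h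
    change IsSum (c (f A).1) (c (f B).1) (c (f C).1)
    rw [← h']
    exact hcadd _ (f A).2 _ (f B).2 (h'.le.trans (f C).2.2)
  · intro q
    obtain ⟨x, rfl⟩ := hD.ideal.proj_surj q
    exact (hproj _ _).2 (hindex _ (hD.index_mem x))
  · intro A B h
    obtain ⟨x, rfl⟩ := hD.ideal.proj_surj A
    obtain ⟨y, rfl⟩ := hD.ideal.proj_surj B
    exact (hproj _ _).2 (congrArg Subtype.val h)
  · rintro ⟨t, ht⟩
    exact ⟨hD.ideal.proj (c t), Subtype.ext (hindex t ht)⟩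

end IsDecomposition

end Decomposition

/-! ### From a strict retractive ideal to a strong perfect decomposition -/

lemma EffectHom.map_zero {E : Type u} {F : Type v} [EffectAlgebra E] [EffectAlgebra F]
    (δ : EffectHom E F) : δ.toFun 0 = 0 :=
  EffectAlgebra.add_left_cancel (δ.map_add (EffectAlgebra.add_zero 0)) (EffectAlgebra.add_zero _)

/-- The homomorphism underlying an isomorphism. -/
def EffectIso.toHom {E : Type u} {F : Type v} [EffectAlgebra E] [EffectAlgebra F]
    (φ : EffectIso E F) : EffectHom E F := ⟨φ.toFun, φ.map_one, φ.map_add⟩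

/-- The inverse of an isomorphism. -/
def EffectIso.symm {E : Type u} {F : Type v} [EffectAlgebra E] [EffectAlgebra F]
    (φ : EffectIso E F) : EffectIso F E where
  toEquiv := φ.toEquiv.symm
  map_one := by
    rw [← φ.map_one]
    exact φ.left_inv 1
  map_add := φ.symm_map_add
  symm_map_add := φ.map_add

lemma EffectIdeal.proj_isSum {E : Type u} [EffectAlgebra E] [RDP E] (I : EffectIdeal E)
    {x y z : E} (h : IsSum x y z) : IsSum (I.proj x) (I.proj y) (I.proj z) :=
  ⟨x, y, z, rfl, rfl, rfl, h⟩

lemma EffectAlgebra.le_compl_of_le {E : Type u} [EffectAlgebra E] {x y : E} (h : le x (compl y)) :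
    le y (compl x) := by
  obtain ⟨c, hc⟩ := h
  obtain ⟨f, hf, hf'⟩ := sum_assoc.1 ⟨_, hc, EffectAlgebra.sum_comm (sum_compl y)⟩
  rw [← eq_compl hf']
  exact ⟨c, EffectAlgebra.sum_comm hf⟩

/-- An ideal that is strict and retractive gives a decomposition indexed by the quotient. -/
theorem EffectIdeal.isStrongPerfect {E : Type u} [EffectAlgebra E] [RDP E] {H : Type v}
    [AddCommGroup H] [PartialOrder H] [IsOrderedAddMonoid H] {a : H} {ha : 0 ≤ a}
    {I : EffectIdeal E} (hI : I.IsStrict) (hI' : I.IsRetractive)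
    (φ : EffectIso I.Quotient (Gam a ha)) : IsStrongPerfect E a := by
  obtain ⟨δ, hδ⟩ := hI'
  let p : E → Gam a ha := fun x => φ.toFun (I.proj x)
  have hp : ∀ {x y z}, IsSum x y z → (p x).1 + (p y).1 = (p z).1 := fun h =>
    φ.map_add (I.proj_isSum h)
  have hp1 : (p 1).1 = a := congrArg Subtype.val φ.map_one
  have hpc : ∀ x, (p (compl x)).1 = a - (p x).1 := fun x =>
    eq_sub_of_add_eq' ((hp (sum_compl x)).trans hp1)
  have hrel : ∀ {x y}, (p x).1 = (p y).1 → I.rel x y := fun h =>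
    I.proj_eq.1 (φ.injective (Subtype.ext h))
  let ψ : EffectHom (Gam a ha) E :=
    ⟨fun t => δ.toFun (φ.symm.toFun t), by rw [φ.symm.map_one, δ.map_one],
      fun h => δ.map_add (φ.symm.map_add h)⟩
  have hpψ : ∀ t, p (ψ.toFun t) = t := fun t => by
    change φ.toFun (I.proj (δ.toFun _)) = t
    rw [hδ]
    exact φ.right_inv t
  have hlow : ∀ x y, (p x).1 = (p y).1 → ∃ z, (p z).1 = (p x).1 ∧ le z x ∧ le z y := by
    intro x y h
    obtain ⟨e, he, f, hf, d, h₁, h₂⟩ := hrel h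
    refine ⟨d, ?_, ⟨e, EffectAlgebra.sum_comm h₁⟩, ⟨f, EffectAlgebra.sum_comm h₂⟩⟩
    refine congrArg (fun q => (φ.toFun q).1) (I.proj_eq.2 ?_)
    exact ⟨0, I.zero_mem, e, he, d, EffectAlgebra.sum_comm (EffectAlgebra.add_zero d), h₁⟩
  classical
  -- The levels are the cosets of `I`, and `c` is the retraction; its value `0` outside `[0, a]` is
  -- never used.
  refine ⟨fun t => {x | (p x).1 = t}, ⟨?_, ?_, ?_, ?_, ?_⟩, ?_, ?_,
    fun t => if ht : t ∈ Set.Icc 0 a then ψ.toFun ⟨t, ht⟩ else 0, ?_, ?_, ?_⟩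
  · exact fun t ht => ⟨ψ.toFun ⟨t, ht⟩, congrArg Subtype.val (hpψ _)⟩
  · intro s _ t _ hst
    refine Set.eq_empty_of_forall_notMem ?_
    rintro x ⟨rfl, h⟩
    exact hst h
  · exact fun x => ⟨_, (p x).2, rfl⟩
  · intro t ht
    refine Set.ext fun x => ⟨?_, fun hx => ⟨compl x, ?_, compl_compl x⟩⟩
    · rintro ⟨y, rfl, rfl⟩
      exact hpc y
    · change (p x).1 = a - t at hx
      change (p (compl x)).1 = t
      rw [hpc, hx, sub_sub_cancel]
  · rintro _ - _ - x rfl y rfl z h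
    rw [hp h]
    exact ⟨(p z).2.2, rfl⟩
  · rintro _ - _ - hst x rfl y rfl
    refine (hI x y ⟨?_, fun h => hst.ne ?_⟩).1
    · have hd : (0 : H) ≤ (p y).1 - (p x).1 := sub_nonneg.2 hst.le
      obtain ⟨q, hq⟩ := φ.surjective ⟨_, hd, (sub_le_self _ (p x).2.1).trans (p y).2.2⟩
      have hq' : (φ.toFun q).1 = (p y).1 - (p x).1 := congrArg Subtype.val hq
      refine ⟨q, φ.isSum_iff.2 ?_⟩
      change (p x).1 + (φ.toFun q).1 = (p y).1
      rw [hq', add_sub_cancel]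
    · exact congrArg (fun q => (φ.toFun q).1) h
  · rintro _ -
    refine ⟨?_, ?_⟩
    · rintro x rfl y hy
      -- Cosets always have common lower bounds; upper bounds come from these by passing to
      -- complements.
      obtain ⟨z, hz, hzx, hzy⟩ := hlow (compl x) (compl y) (by rw [hpc, hpc, hy])
      refine ⟨compl z, ?_, le_compl_of_le hzx, le_compl_of_le hzy⟩
      change (p (compl z)).1 = _
      rw [hpc, hz, hpc, sub_sub_cancel]
    · rintro x rfl y hy
      exact hlow x y (Eq.symm hy)
  · intro t ht
    simp only [dif_pos ht]
    exact congrArg Subtype.val (hpψ _)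
  · intro s hs t ht hst
    simp only [dif_pos hs, dif_pos ht, dif_pos (show s + t ∈ Set.Icc 0 a from
      ⟨add_nonneg hs.1 ht.1, hst⟩)]
    exact ψ.map_add rfl
  · exact (dif_pos (show a ∈ Set.Icc 0 a from ⟨ha, le_rfl⟩)).trans ψ.map_one

theorem isStrongPerfect_iff {E : Type u} [EffectAlgebra E] [RDP E] {H : Type v}
    [AddCommGroup H] [PartialOrder H] [IsOrderedAddMonoid H] {a : H} (ha : 0 ≤ a) :
    IsStrongPerfect E a ↔ ∃ I : EffectIdeal E, I.IsStrict ∧ I.IsRetractive ∧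
      Nonempty (EffectIso I.Quotient (Gam a ha)) := by
  constructor
  · rintro ⟨D, hD, hord, hdir, c, hc, hcadd, hc1⟩
    exact ⟨hD.ideal, hD.exists_strict_retractive hord hdir hc hcadd hc1⟩
  · rintro ⟨I, hI, hI', ⟨φ⟩⟩
    exact EffectIdeal.isStrongPerfect hI hI' φ

/-! ### RDP for lexicographic products -/

section Lexicographic

lemma lex_le_unit_iff {H : Type v} [PartialOrder H] {G : Type w} [AddCommGroup G] [PartialOrder G]
    {x : H × G} {a : H} : toLex x ≤ lexUnit G a ↔ x.1 ≤ a ∧ (x.1 = a → x.2 ≤ 0) :=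
  Prod.Lex.le_iff'

variable {H : Type v} [AddCommGroup H] {G : Type w} [AddCommGroup G] [PartialOrder G]

lemma lex_nonneg_iff [PartialOrder H] {x : H × G} : 0 ≤ toLex x ↔ 0 ≤ x.1 ∧ (x.1 = 0 → 0 ≤ x.2) := by
  rw [Prod.Lex.le_iff', eq_comm (a := x.1)]
  rfl

lemma nonneg_of_lexUnit_nonneg [PartialOrder H] {a : H} (hu : 0 ≤ lexUnit G a) : 0 ≤ a :=
  (lex_nonneg_iff.1 hu).1

variable [IsOrderedAddMonoid G]

lemma exists_le_le_of_isDirectedOrder [IsDirectedOrder G] (x y : G) : ∃ z, z ≤ x ∧ z ≤ y := by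
  obtain ⟨z, hx, hy⟩ := exists_ge_ge (-x) (-y)
  exact ⟨-z, neg_le.1 hx, neg_le.1 hy⟩

/-- Refinement of the second coordinates in a lexicographic product when the refinement of the
first coordinates has a nonzero entry. -/
lemma exists_lex_refinement [IsDirectedOrder G] {c₁₁ c₁₂ c₂₁ c₂₂ : H} (h₂₂ : c₂₂ ≠ 0)
    {g₁ g₂ l₁ l₂ : G} (h : g₁ + g₂ = l₁ + l₂) (hg : c₁₁ = 0 → c₁₂ = 0 → 0 ≤ g₁)
    (hl : c₁₁ = 0 → c₂₁ = 0 → 0 ≤ l₁) :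
    ∃ d₁₁ d₁₂ d₂₁ d₂₂ : G, (c₁₁ = 0 → 0 ≤ d₁₁) ∧ (c₁₂ = 0 → 0 ≤ d₁₂) ∧ (c₂₁ = 0 → 0 ≤ d₂₁) ∧
      (c₂₂ = 0 → 0 ≤ d₂₂) ∧ g₁ = d₁₁ + d₁₂ ∧ g₂ = d₂₁ + d₂₂ ∧ l₁ = d₁₁ + d₂₁ ∧
      l₂ = d₁₂ + d₂₂ := by
  -- A 2 × 2 table with given row and column sums is determined by its upper left entry `d`. Since
  -- `c₂₂ ≠ 0` the lower right entry is unconstrained, so `d` only has to meet the bounds from the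
  -- other three. If `c₁₁ = 0`, then `d = 0` meets them; otherwise any common lower bound of `g₁`
  -- and `l₁` does.
  have key : ∃ d : G, (c₁₁ = 0 → 0 ≤ d) ∧ (c₁₂ = 0 → d ≤ g₁) ∧ (c₂₁ = 0 → d ≤ l₁) := by
    by_cases h₁₁ : c₁₁ = 0
    · exact ⟨0, fun _ => le_rfl, hg h₁₁, hl h₁₁⟩
    · obtain ⟨d, h₁, h₂⟩ := exists_le_le_of_isDirectedOrder g₁ l₁
      exact ⟨d, fun h => absurd h h₁₁, fun _ => h₁, fun _ => h₂⟩
  obtain ⟨d, h₁, h₂, h₃⟩ := key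
  have hg₂ : g₂ = l₁ + l₂ - g₁ := eq_sub_of_add_eq' h
  refine ⟨d, g₁ - d, l₁ - d, l₂ - g₁ + d, h₁, fun h => sub_nonneg.2 (h₂ h),
    fun h => sub_nonneg.2 (h₃ h), fun h => absurd h h₂₂, ?_, ?_, ?_, ?_⟩
  · abel
  · rw [hg₂]
    abel
  · abel
  · abel

/-- After the first coordinates are refined, a second coordinate must be positive only where the
first one vanishes. If some first coordinate is nonzero, permuting rows and columns moves it to the
lower right corner of `exists_lex_refinement`; if all vanish, RDP of `G` applies. -/
theorem GroupRDP.lex [PartialOrder H] [IsOrderedAddMonoid H] [IsDirectedOrder G] (hH : GroupRDP H)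
    (hG : GroupRDP G) : GroupRDP (H ×ₗ G) := by
  rintro ⟨h₁, g₁⟩ ⟨h₂, g₂⟩ ⟨k₁, l₁⟩ ⟨k₂, l₂⟩ hg₁ hg₂ hl₁ hl₂ hs
  obtain ⟨hh₁, hg₁⟩ := lex_nonneg_iff.1 hg₁
  obtain ⟨hh₂, hg₂⟩ := lex_nonneg_iff.1 hg₂
  obtain ⟨hk₁, hl₁⟩ := lex_nonneg_iff.1 hl₁
  obtain ⟨hk₂, hl₂⟩ := lex_nonneg_iff.1 hl₂
  have hs₁ : h₁ + h₂ = k₁ + k₂ := congrArg (fun x => (ofLex x).1) hs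
  have hs₂ : g₁ + g₂ = l₁ + l₂ := congrArg (fun x => (ofLex x).2) hs
  dsimp only at hh₁ hh₂ hk₁ hk₂ hg₁ hg₂ hl₁ hl₂
  obtain ⟨c₁₁, c₁₂, c₂₁, c₂₂, p₁₁, p₁₂, p₂₁, p₂₂, rfl, rfl, rfl, rfl⟩ :=
    hH h₁ h₂ k₁ k₂ hh₁ hh₂ hk₁ hk₂ hs₁
  suffices key : ∃ d₁₁ d₁₂ d₂₁ d₂₂ : G, (c₁₁ = 0 → 0 ≤ d₁₁) ∧ (c₁₂ = 0 → 0 ≤ d₁₂) ∧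
      (c₂₁ = 0 → 0 ≤ d₂₁) ∧ (c₂₂ = 0 → 0 ≤ d₂₂) ∧ g₁ = d₁₁ + d₁₂ ∧ g₂ = d₂₁ + d₂₂ ∧
      l₁ = d₁₁ + d₂₁ ∧ l₂ = d₁₂ + d₂₂ by
    obtain ⟨d₁₁, d₁₂, d₂₁, d₂₂, q₁₁, q₁₂, q₂₁, q₂₂, rfl, rfl, rfl, rfl⟩ := key
    exact ⟨toLex (c₁₁, d₁₁), toLex (c₁₂, d₁₂), toLex (c₂₁, d₂₁), toLex (c₂₂, d₂₂),
      lex_nonneg_iff.2 ⟨p₁₁, q₁₁⟩, lex_nonneg_iff.2 ⟨p₁₂, q₁₂⟩, lex_nonneg_iff.2 ⟨p₂₁, q₂₁⟩,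
      lex_nonneg_iff.2 ⟨p₂₂, q₂₂⟩, rfl, rfl, rfl, rfl⟩
  have hg₁' : c₁₁ = 0 → c₁₂ = 0 → 0 ≤ g₁ := fun h h' => hg₁ (by rw [h, h', _root_.add_zero])
  have hg₂' : c₂₁ = 0 → c₂₂ = 0 → 0 ≤ g₂ := fun h h' => hg₂ (by rw [h, h', _root_.add_zero])
  have hl₁' : c₁₁ = 0 → c₂₁ = 0 → 0 ≤ l₁ := fun h h' => hl₁ (by rw [h, h', _root_.add_zero])
  have hl₂' : c₁₂ = 0 → c₂₂ = 0 → 0 ≤ l₂ := fun h h' => hl₂ (by rw [h, h', _root_.add_zero])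
  by_cases h₂₂ : c₂₂ ≠ 0
  · exact exists_lex_refinement h₂₂ hs₂ hg₁' hl₁'
  by_cases h₂₁ : c₂₁ ≠ 0
  · obtain ⟨d₁, d₂, d₃, d₄, q₁, q₂, q₃, q₄, e₁, e₂, e₃, e₄⟩ :=
      exists_lex_refinement h₂₁ (hs₂.trans (add_comm _ _)) (fun h h' => hg₁' h' h) hl₂'
    exact ⟨d₂, d₁, d₄, d₃, q₂, q₁, q₄, q₃, e₁.trans (add_comm _ _), e₂.trans (add_comm _ _),
      e₄, e₃⟩
  by_cases h₁₂ : c₁₂ ≠ 0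
  · obtain ⟨d₁, d₂, d₃, d₄, q₁, q₂, q₃, q₄, e₁, e₂, e₃, e₄⟩ :=
      exists_lex_refinement h₁₂ ((add_comm _ _).trans hs₂) hg₂' (fun h h' => hl₁' h' h)
    exact ⟨d₃, d₄, d₁, d₂, q₃, q₄, q₁, q₂, e₂, e₁, e₃.trans (add_comm _ _),
      e₄.trans (add_comm _ _)⟩
  by_cases h₁₁ : c₁₁ ≠ 0
  · obtain ⟨d₁, d₂, d₃, d₄, q₁, q₂, q₃, q₄, e₁, e₂, e₃, e₄⟩ :=
      exists_lex_refinement h₁₁ ((add_comm _ _).trans (hs₂.trans (add_comm _ _)))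
        (fun h h' => hg₂' h' h) (fun h h' => hl₂' h' h)
    exact ⟨d₄, d₃, d₂, d₁, q₄, q₃, q₂, q₁, e₂.trans (add_comm _ _), e₁.trans (add_comm _ _),
      e₄.trans (add_comm _ _), e₃.trans (add_comm _ _)⟩
  rw [not_not] at h₁₁ h₁₂ h₂₁ h₂₂
  obtain ⟨d₁, d₂, d₃, d₄, q₁, q₂, q₃, q₄, e⟩ := hG g₁ g₂ l₁ l₂ (hg₁' h₁₁ h₁₂) (hg₂' h₂₁ h₂₂)
    (hl₁' h₁₁ h₂₁) (hl₂' h₁₂ h₂₂) hs₂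
  exact ⟨d₁, d₂, d₃, d₄, fun _ => q₁, fun _ => q₂, fun _ => q₃, fun _ => q₄, e⟩

end Lexicographic

/-! ### RDP in intervals, and its transfer along isomorphisms -/

lemma Gam.le_iff {K : Type v} [AddCommGroup K] [PartialOrder K] [IsOrderedAddMonoid K] {a : K}
    {ha : 0 ≤ a} {x y : Gam a ha} : le x y ↔ x.1 ≤ y.1 := by
  constructor
  · rintro ⟨c, hc⟩
    replace hc : x.1 + c.1 = y.1 := hc
    rw [← hc]
    exact le_add_of_nonneg_right c.2.1
  · intro h
    exact ⟨⟨y.1 - x.1, sub_nonneg.2 h, (sub_le_self _ x.2.1).trans y.2.2⟩,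
      add_sub_cancel x.1 y.1⟩

theorem GroupRDP.rdp_gam {K : Type v} [AddCommGroup K] [PartialOrder K] [IsOrderedAddMonoid K]
    (hK : GroupRDP K) {a : K} (ha : 0 ≤ a) : RDP (Gam a ha) where
  decomposition := by
    intro a₁ a₂ b₁ b₂ s h h'
    obtain ⟨c₁, c₂, c₃, c₄, p₁, p₂, p₃, p₄, e₁, e₂, e₃, e₄⟩ := hK a₁.1 a₂.1 b₁.1 b₂.1 a₁.2.1
      a₂.2.1 b₁.2.1 b₂.2.1 (Eq.trans h (Eq.symm h'))
    exact ⟨⟨c₁, p₁, (le_add_of_nonneg_right p₂).trans (e₁.ge.trans a₁.2.2)⟩,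
      ⟨c₂, p₂, (le_add_of_nonneg_left p₁).trans (e₁.ge.trans a₁.2.2)⟩,
      ⟨c₃, p₃, (le_add_of_nonneg_right p₄).trans (e₂.ge.trans a₂.2.2)⟩,
      ⟨c₄, p₄, (le_add_of_nonneg_left p₃).trans (e₂.ge.trans a₂.2.2)⟩,
      e₁.symm, e₂.symm, e₃.symm, e₄.symm⟩

theorem EffectIso.rdp {E : Type u} {F : Type v} [EffectAlgebra E] [EffectAlgebra F]
    (φ : EffectIso E F) [RDP F] : RDP E where
  decomposition := by
    intro a₁ a₂ b₁ b₂ s h h'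
    obtain ⟨c₁, c₂, c₃, c₄, e₁, e₂, e₃, e₄⟩ := RDP.decomposition (φ.map_add h) (φ.map_add h')
    have key : ∀ {c d : F} {x : E}, IsSum c d (φ.toFun x) →
        IsSum (φ.invFun c) (φ.invFun d) x := fun {c d x} h => by
      have := φ.symm_map_add h
      rwa [φ.left_inv] at this
    exact ⟨_, _, _, _, key e₁, key e₂, key e₃, key e₄⟩

/-! ### Effect algebras that are lexicographic intervals -/

section LexInterval

variable {E : Type u} [EffectAlgebra E] {H : Type v} [AddCommGroup H] [PartialOrder H]
  [IsOrderedAddMonoid H] {G : Type w} [AddCommGroup G] [PartialOrder G] [IsOrderedAddMonoid G]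
  {a : H}

namespace EffectIso

variable {hu : 0 ≤ lexUnit G a} (φ : EffectIso E (Gam (lexUnit G a) hu))

/-- The coordinates of an element under an isomorphism with an interval of a lexicographic
product. -/
def coord (x : E) : H × G := ofLex (φ.toFun x).1

lemma coord_nonneg (x : E) : 0 ≤ (φ.coord x).1 ∧ ((φ.coord x).1 = 0 → 0 ≤ (φ.coord x).2) :=
  lex_nonneg_iff.1 (φ.toFun x).2.1

lemma coord_le (x : E) : (φ.coord x).1 ≤ a ∧ ((φ.coord x).1 = a → (φ.coord x).2 ≤ 0) :=
  lex_le_unit_iff.1 (φ.toFun x).2.2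

lemma coord_one : φ.coord 1 = (a, 0) := congrArg (fun x => ofLex x.1) φ.map_one

lemma coord_injective : Function.Injective φ.coord := fun _ _ h =>
  φ.injective (Subtype.ext (ofLex.injective h))

lemma exists_coord_eq {t : H} {g : G} (h₁ : 0 ≤ t) (h₂ : t = 0 → 0 ≤ g) (h₃ : t ≤ a)
    (h₄ : t = a → g ≤ 0) : ∃ x, φ.coord x = (t, g) := by
  obtain ⟨x, hx⟩ := φ.surjective
    ⟨toLex (t, g), lex_nonneg_iff.2 ⟨h₁, h₂⟩, lex_le_unit_iff.2 ⟨h₃, h₄⟩⟩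
  exact ⟨x, congrArg (fun x => ofLex x.1) hx⟩

lemma isSum_iff_coord {x y z : E} : IsSum x y z ↔ φ.coord x + φ.coord y = φ.coord z :=
  φ.isSum_iff

lemma coord_compl (x : E) : φ.coord (compl x) = (a, 0) - φ.coord x :=
  eq_sub_of_add_eq' ((φ.isSum_iff_coord.1 (sum_compl x)).trans φ.coord_one)

lemma le_iff_coord {x y : E} : le x y ↔ (φ.coord x).1 ≤ (φ.coord y).1 ∧
    ((φ.coord x).1 = (φ.coord y).1 → (φ.coord x).2 ≤ (φ.coord y).2) := by
  refine Iff.trans ?_ ((Gam.le_iff (x := φ.toFun x) (y := φ.toFun y)).trans Prod.Lex.le_iff')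
  constructor
  · rintro ⟨c, hc⟩
    exact ⟨_, φ.map_add hc⟩
  · rintro ⟨c, hc⟩
    obtain ⟨d, rfl⟩ := φ.surjective c
    exact ⟨d, φ.isSum_iff.2 hc⟩

theorem isDecomposition_coord : IsDecomposition a fun t => {x | (φ.coord x).1 = t} where
  nonempty t ht := by
    obtain ⟨x, hx⟩ := φ.exists_coord_eq (g := 0) ht.1 (fun _ => le_rfl) ht.2 (fun _ => le_rfl)
    exact ⟨x, congrArg Prod.fst hx⟩
  disjoint s _ t _ hst := by
    refine Set.eq_empty_of_forall_notMem ?_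
    rintro x ⟨rfl, h⟩
    exact hst h
  cover x := ⟨_, ⟨(φ.coord_nonneg x).1, (φ.coord_le x).1⟩, rfl⟩
  compl_eq t ht := by
    have h : ∀ x, (φ.coord (compl x)).1 = a - (φ.coord x).1 := fun x =>
      congrArg Prod.fst (φ.coord_compl x)
    refine Set.ext fun x => ⟨?_, fun hx => ⟨compl x, ?_, compl_compl x⟩⟩
    · rintro ⟨y, rfl, rfl⟩
      exact h y
    · change (φ.coord x).1 = a - t at hx
      change (φ.coord (compl x)).1 = t
      rw [h, hx, sub_sub_cancel]
  sum_mem := by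
    rintro _ - _ - x rfl y rfl z h
    have h' : (φ.coord x).1 + (φ.coord y).1 = (φ.coord z).1 :=
      congrArg Prod.fst (φ.isSum_iff_coord.1 h)
    exact ⟨h'.le.trans (φ.coord_le z).1, h'.symm⟩

theorem isDirectedSet_coord [IsDirectedOrder G] {t : H} (ht : t ∈ Set.Icc 0 a) :
    IsDirectedSet {x | (φ.coord x).1 = t} := by
  have hle : ∀ x y, (φ.coord x).1 = (φ.coord y).1 → (φ.coord x).2 ≤ (φ.coord y).2 → le x y :=
    fun x y h h' => φ.le_iff_coord.2 ⟨h.le, fun _ => h'⟩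
  constructor
  · rintro x rfl y hy
    replace hy : (φ.coord y).1 = (φ.coord x).1 := hy
    -- On the top level second coordinates may not exceed `0`, so `0` is itself the bound; below it,
    -- directedness of `G` supplies one. The lower bounds are dual, with the bottom level as the
    -- exception.
    have : ∃ g, (φ.coord x).2 ≤ g ∧ (φ.coord y).2 ≤ g ∧ ((φ.coord x).1 = a → g ≤ 0) := by
      by_cases h : (φ.coord x).1 = a
      · exact ⟨0, (φ.coord_le x).2 h, (φ.coord_le y).2 (hy.trans h), fun _ => le_rfl⟩
      · obtain ⟨g, h₁, h₂⟩ := exists_ge_ge (φ.coord x).2 (φ.coord y).2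
        exact ⟨g, h₁, h₂, fun h' => absurd h' h⟩
    obtain ⟨g, h₁, h₂, h₃⟩ := this
    obtain ⟨z, hz⟩ := φ.exists_coord_eq (g := g) ht.1
      (fun h => ((φ.coord_nonneg x).2 h).trans h₁) ht.2 h₃
    exact ⟨z, (congrArg Prod.fst hz :), hle _ _ (by rw [hz]) (by rwa [hz]),
      hle _ _ (by rw [hz, hy]) (by rwa [hz])⟩
  · rintro x rfl y hy
    replace hy : (φ.coord y).1 = (φ.coord x).1 := hy
    have : ∃ g, g ≤ (φ.coord x).2 ∧ g ≤ (φ.coord y).2 ∧ ((φ.coord x).1 = 0 → 0 ≤ g) := by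
      by_cases h : (φ.coord x).1 = 0
      · exact ⟨0, (φ.coord_nonneg x).2 h, (φ.coord_nonneg y).2 (hy.trans h), fun _ => le_rfl⟩
      · obtain ⟨g, h₁, h₂⟩ := exists_le_le_of_isDirectedOrder (φ.coord x).2 (φ.coord y).2
        exact ⟨g, h₁, h₂, fun h' => absurd h' h⟩
    obtain ⟨g, h₁, h₂, h₃⟩ := this
    obtain ⟨z, hz⟩ := φ.exists_coord_eq (g := g) ht.1 h₃ ht.2
      (fun h => h₁.trans ((φ.coord_le x).2 h))
    exact ⟨z, (congrArg Prod.fst hz :), hle _ _ (by rw [hz]) (by rwa [hz]),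
      hle _ _ (by rw [hz, hy]) (by rwa [hz])⟩

/-- Complementation exchanges the bottom and the top level, so the generated subalgebra contains
both. Their union is closed under sums, because two top elements cannot be added when `a ≠ 0`. -/
lemma mem_generated_iff (ha' : a ≠ 0) {I : EffectIdeal E}
    (hI : I.carrier = {x | (φ.coord x).1 = 0}) {x : E} :
    x ∈ (EffectSubalgebra.generated I.carrier).carrier ↔
      (φ.coord x).1 = 0 ∨ (φ.coord x).1 = a := by
  have hcompl : ∀ x, (φ.coord (compl x)).1 = a - (φ.coord x).1 := fun x =>
    congrArg Prod.fst (φ.coord_compl x)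
  constructor
  · intro hx
    refine hx ⟨{x | (φ.coord x).1 = 0 ∨ (φ.coord x).1 = a}, ?_, ?_, ?_⟩ ?_
    · exact Or.inr (congrArg Prod.fst φ.coord_one)
    · rintro x (h | h)
      · exact Or.inr (by rw [hcompl, h, sub_zero])
      · exact Or.inl (by rw [hcompl, h, sub_self])
    · intro x y z hx hy h
      have h' : (φ.coord x).1 + (φ.coord y).1 = (φ.coord z).1 :=
        congrArg Prod.fst (φ.isSum_iff_coord.1 h)
      have hz := (φ.coord_le z).1
      change (φ.coord z).1 = 0 ∨ (φ.coord z).1 = a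
      rw [← h'] at hz ⊢
      rcases hx with hx | hx <;> rcases hy with hy | hy <;> rw [hx, hy] at hz ⊢
      · exact Or.inl (_root_.add_zero 0)
      · exact Or.inr (zero_add a)
      · exact Or.inr (_root_.add_zero a)
      · exact absurd (le_antisymm (add_le_iff_nonpos_left.1 hz) (nonneg_of_lexUnit_nonneg hu))
          ha'
    · rw [hI]
      exact fun _ => Or.inl
  · rintro (h | h) F hF
    · exact hF (hI ▸ h)
    · rw [← compl_compl x]
      refine F.compl_mem (hF ?_)
      rw [hI]
      change (φ.coord (compl x)).1 = 0
      rw [hcompl, h, sub_self]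

/-- Elements of the interval over `ℤ` have first coordinate `0` or `1`. Sending `(n, g)` to the
element with coordinates `(n • a, g)` matches these with the bottom and top levels, injectively
since `a > 0`. -/
theorem nonempty_generated_iso (ha' : a ≠ 0) {I : EffectIdeal E}
    (hI : I.carrier = {x | (φ.coord x).1 = 0}) :
    Nonempty (EffectIso (EffectSubalgebra.generated I.carrier).Elem
      (Gam (lexUnit G (1 : ℤ)) (lexUnit_nonneg G zero_le_one))) := by
  have ha : 0 ≤ a := nonneg_of_lexUnit_nonneg hu
  have hinj : Function.Injective fun n : ℤ => n • a :=
    (zsmul_left_strictMono (ha.lt_of_ne ha'.symm)).injective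
  have hn : ∀ w : Gam (lexUnit G (1 : ℤ)) (lexUnit_nonneg G zero_le_one),
      (ofLex w.1).1 = 0 ∧ 0 ≤ (ofLex w.1).2 ∨ (ofLex w.1).1 = 1 ∧ (ofLex w.1).2 ≤ 0 := by
    intro w
    obtain ⟨h₁, h₂⟩ := lex_nonneg_iff.1 w.2.1
    obtain ⟨h₃, h₄⟩ := lex_le_unit_iff.1 w.2.2
    have h₁' : 0 ≤ (ofLex w.1).1 := h₁
    have h₃' : (ofLex w.1).1 ≤ 1 := h₃
    rcases (by omega : (ofLex w.1).1 = 0 ∨ (ofLex w.1).1 = 1) with h | h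
    · exact Or.inl ⟨h, h₂ h⟩
    · exact Or.inr ⟨h, h₄ h⟩
  have hex : ∀ w : Gam (lexUnit G (1 : ℤ)) (lexUnit_nonneg G zero_le_one),
      ∃ x : (EffectSubalgebra.generated I.carrier).Elem,
        φ.coord x.1 = ((ofLex w.1).1 • a, (ofLex w.1).2) := by
    intro w
    rcases hn w with ⟨h, h'⟩ | ⟨h, h'⟩
    · obtain ⟨x, hx⟩ := φ.exists_coord_eq (g := (ofLex w.1).2) le_rfl (fun _ => h') ha
        (fun h => absurd h.symm ha')
      exact ⟨⟨x, (φ.mem_generated_iff ha' hI).2 (Or.inl (congrArg Prod.fst hx))⟩,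
        by rw [h, zero_smul]; exact hx⟩
    · obtain ⟨x, hx⟩ := φ.exists_coord_eq (g := (ofLex w.1).2) ha (fun h => absurd h ha') le_rfl
        (fun _ => h')
      exact ⟨⟨x, (φ.mem_generated_iff ha' hI).2 (Or.inr (congrArg Prod.fst hx))⟩,
        by rw [h, one_smul]; exact hx⟩
  choose f hf using hex
  refine ⟨(EffectIso.ofBijective f ⟨?_, ?_⟩ ?_ ?_).symm⟩
  · intro w w' h
    have h' := hf w
    rw [h, hf w'] at h'
    refine Subtype.ext (ofLex.injective (Prod.ext (hinj ?_) ?_))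
    · exact (congrArg Prod.fst h').symm
    · exact (congrArg Prod.snd h').symm
  · rintro ⟨x, hx⟩
    rcases (φ.mem_generated_iff ha' hI).1 hx with h | h
    · refine ⟨⟨toLex (0, (φ.coord x).2), lex_nonneg_iff.2 ⟨le_rfl, fun _ =>
        (φ.coord_nonneg x).2 h⟩, lex_le_unit_iff.2 ⟨zero_le_one, fun h => absurd h zero_ne_one⟩⟩,
        Subtype.ext (φ.coord_injective ?_)⟩
      exact (hf _).trans <| Prod.ext ((zero_smul ℤ a).trans h.symm) rfl
    · refine ⟨⟨toLex (1, (φ.coord x).2), lex_nonneg_iff.2 ⟨zero_le_one, fun h =>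
        absurd h one_ne_zero⟩, lex_le_unit_iff.2 ⟨le_rfl, fun _ => (φ.coord_le x).2 h⟩⟩,
        Subtype.ext (φ.coord_injective ?_)⟩
      exact (hf _).trans <| Prod.ext ((one_smul ℤ a).trans h.symm) rfl
  · refine Subtype.ext (φ.coord_injective ?_)
    exact (hf _).trans <| (Prod.ext (one_smul ℤ a) rfl : ((1 : ℤ) • a, (0 : G)) = (a, 0)).trans φ.coord_one.symm
  · intro x y z
    change _ ↔ IsSum (f x).1 (f y).1 (f z).1
    rw [φ.isSum_iff_coord, hf, hf, hf, Prod.mk_add_mk, Prod.mk_inj, ← add_smul, hinj.eq_iff]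
    change x.1 + y.1 = z.1 ↔ _
    rw [← ofLex.injective.eq_iff, Prod.ext_iff]
    rfl

end EffectIso

theorem exists_strict_retractive_of_lex [IsDirectedOrder G] [RDP E] (ha : 0 ≤ a) (ha' : a ≠ 0)
    (φ : EffectIso E (Gam (lexUnit G a) (lexUnit_nonneg G ha))) :
    ∃ I : EffectIdeal E, I.carrier ≠ Set.univ ∧ I.IsStrict ∧ I.IsRetractive ∧
      Nonempty (EffectIso I.Quotient (Gam a ha)) ∧
      Nonempty (EffectIso (EffectSubalgebra.generated I.carrier).Elem
        (Gam (lexUnit G (1 : ℤ)) (lexUnit_nonneg G zero_le_one))) := by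
  have hex : ∀ t, ∃ x, t ∈ Set.Icc 0 a → φ.coord x = (t, 0) := fun t => by
    by_cases ht : t ∈ Set.Icc 0 a
    · obtain ⟨x, hx⟩ := φ.exists_coord_eq (g := 0) ht.1 (fun _ => le_rfl) ht.2 (fun _ => le_rfl)
      exact ⟨x, fun _ => hx⟩
    · exact ⟨0, fun h => absurd h ht⟩
  choose c hc using hex
  have hD := φ.isDecomposition_coord
  have hord : ∀ s ∈ Set.Icc 0 a, ∀ t ∈ Set.Icc 0 a, s < t → ∀ x ∈ {x | (φ.coord x).1 = s},
      ∀ y ∈ {x | (φ.coord x).1 = t}, le x y := by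
    rintro _ - _ - hst x rfl y rfl
    exact φ.le_iff_coord.2 ⟨hst.le, fun h => absurd h hst.ne⟩
  have hadd : ∀ s ∈ Set.Icc 0 a, ∀ t ∈ Set.Icc 0 a, s + t ≤ a →
      IsSum (c s) (c t) (c (s + t)) := by
    intro s hs t ht hst
    rw [φ.isSum_iff_coord, hc s hs, hc t ht, hc _ ⟨add_nonneg hs.1 ht.1, hst⟩, Prod.mk_add_mk,
      _root_.add_zero]
  obtain ⟨h₁, h₂, h₃⟩ := hD.exists_strict_retractive hord
    (fun t ht => φ.isDirectedSet_coord ht) (fun t ht => congrArg Prod.fst (hc t ht)) hadd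
    (φ.coord_injective ((hc a ⟨ha, le_rfl⟩).trans φ.coord_one.symm))
  refine ⟨hD.ideal, fun h => ?_, h₁, h₂, h₃, φ.nonempty_generated_iso ha' rfl⟩
  have h1 : (1 : E) ∈ hD.ideal.carrier := h ▸ Set.mem_univ _
  have h1' : (φ.coord 1).1 = 0 := h1
  rw [φ.coord_one] at h1'
  exact ha' h1'

end LexInterval

lemma IsStrongUnit.ne_zero {H : Type v} [AddCommGroup H] [PartialOrder H] [IsOrderedAddMonoid H]
    [Nontrivial H] {a : H} (ha : IsStrongUnit a) : a ≠ 0 := by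
  rintro rfl
  obtain ⟨x, hx⟩ := exists_ne (0 : H)
  have h : ∀ y : H, y ≤ 0 := fun y => by
    obtain ⟨n, hn⟩ := ha.2 y
    rwa [smul_zero] at hn
  exact hx (le_antisymm (h x) (neg_nonpos.1 (h (-x))))

/-! ### Quotients, strict ideals, and an ideal as a positive cone -/

namespace EffectAlgebra

variable {E : Type u} [EffectAlgebra E]

lemma isSum_add_add_comm {a b c d x y z : E} (h₁ : IsSum a b x) (h₂ : IsSum c d y)
    (h : IsSum x y z) : ∃ m n, IsSum a c m ∧ IsSum b d n ∧ IsSum m n z := by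
  obtain ⟨r, hr, hr'⟩ := sum_assoc.1 ⟨x, h₁, h⟩
  obtain ⟨s, hs, hs'⟩ := sum_assoc.1 ⟨y, h₂, sum_comm hr⟩
  obtain ⟨m, hm, hm'⟩ := sum_assoc.2 ⟨r, hs', hr'⟩
  exact ⟨m, s, hm, sum_comm hs, hm'⟩

lemma exists_isSum_of_le_compl {x y : E} (h : le x (compl y)) : ∃ z, IsSum x y z := by
  obtain ⟨c, hc⟩ := h
  obtain ⟨z, hz, -⟩ := sum_assoc.1 ⟨_, sum_comm hc, sum_comm (sum_compl y)⟩
  exact ⟨z, hz⟩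

end EffectAlgebra

namespace EffectIdeal

variable {E : Type u} [EffectAlgebra E]

section Quotient

variable [RDP E] (I : EffectIdeal E)

lemma proj_eq_zero_iff {x : E} : I.proj x = 0 ↔ x ∈ I.carrier := by
  refine I.proj_eq.trans ⟨?_, fun hx => ⟨x, hx, 0, I.zero_mem, 0, EffectAlgebra.add_zero x,
    EffectAlgebra.add_zero 0⟩⟩
  rintro ⟨e, he, f, hf, d, h₁, h₂⟩
  rw [eq_zero_of_isSum_zero (EffectAlgebra.sum_comm h₂)] at h₁
  exact I.sum_mem he I.zero_mem h₁

lemma proj_add_mem {x e y : E} (he : e ∈ I.carrier) (h : IsSum e x y) : I.proj y = I.proj x :=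
  I.proj_eq.2 ⟨e, he, 0, I.zero_mem, x, h, EffectAlgebra.sum_comm (EffectAlgebra.add_zero x)⟩

lemma proj_compl_mem {x : E} (hx : x ∈ I.carrier) : I.proj (compl x) = 1 :=
  (I.proj_add_mem hx (sum_compl x)).symm

/-- A decomposition of an element of a coset restricts to a decomposition of an element of that
coset which lies below a given one. -/
lemma exists_isSum_of_rel {a₁ a₂ s e d : E} (h : IsSum a₁ a₂ s) (he : e ∈ I.carrier)
    (hd : IsSum e d s) :
    ∃ b₁ b₂, I.proj b₁ = I.proj a₁ ∧ I.proj b₂ = I.proj a₂ ∧ IsSum b₁ b₂ d := by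
  obtain ⟨x, y, z, t, hx, hy, hz, ht⟩ := RDP.decomposition h hd
  exact ⟨y, t, (I.proj_add_mem (I.mem_of_le ⟨z, hz⟩ he) hx).symm,
    (I.proj_add_mem (I.mem_of_le ⟨x, EffectAlgebra.sum_comm hz⟩ he) hy).symm, ht⟩

/-- The two representatives of the common sum differ only by elements of `I`. Both decompositions
can be cut down to a common lower bound without changing cosets, and then RDP of `E` refines them.
-/
instance : RDP I.Quotient where
  decomposition := by
    rintro _ _ _ _ _ ⟨a₁, a₂, s, rfl, rfl, rfl, h⟩ ⟨b₁, b₂, s', rfl, rfl, hs, h'⟩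
    obtain ⟨e, he, f, hf, d, h₁, h₂⟩ := I.proj_eq.1 hs
    obtain ⟨x₁, x₂, hx₁, hx₂, hx⟩ := I.exists_isSum_of_rel h hf h₂
    obtain ⟨y₁, y₂, hy₁, hy₂, hy⟩ := I.exists_isSum_of_rel h' he h₁
    obtain ⟨c₁, c₂, c₃, c₄, e₁, e₂, e₃, e₄⟩ := RDP.decomposition hx hy
    rw [← hx₁, ← hx₂, ← hy₁, ← hy₂]
    exact ⟨_, _, _, _, I.proj_isSum e₁, I.proj_isSum e₂, I.proj_isSum e₃, I.proj_isSum e₄⟩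

variable {I}

lemma IsStrict.le_of_mem (hI : I.IsStrict) {h x : E} (hh : h ∈ I.carrier) (hx : I.proj x ≠ 0) :
    le h x := by
  rw [← I.proj_eq_zero_iff] at hh
  refine (hI h x ⟨⟨I.proj x, ?_⟩, ?_⟩).1
  · rw [hh]
    exact EffectAlgebra.sum_comm (EffectAlgebra.add_zero _)
  · rw [hh]
    exact hx.symm

/-- The complement of an element of `I` lies in the top coset, so by strictness it is above
everything outside that coset. -/
lemma IsStrict.exists_isSum_of_mem (hI : I.IsStrict) {x h : E} (hh : h ∈ I.carrier)
    (hx : I.proj x ≠ 1) : ∃ z, IsSum x h z := by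
  refine exists_isSum_of_le_compl (hI x (compl h) ⟨?_, ?_⟩).1
  · rw [I.proj_compl_mem hh]
    exact ⟨_, sum_compl _⟩
  · rwa [I.proj_compl_mem hh]

lemma zero_ne_one_of_ne_univ (hI : I.carrier ≠ Set.univ) : (0 : I.Quotient) ≠ 1 := fun h =>
  hI <| Set.eq_univ_of_forall fun x =>
    I.mem_of_le ⟨_, sum_compl x⟩ (I.proj_eq_zero_iff.1 h.symm)

end Quotient

/-- The sum of two elements of an ideal with total addition. -/
noncomputable abbrev addOfTotal (I : EffectIdeal E)
    (h : ∀ x y : {x // x ∈ I.carrier}, ∃ z, IsSum x.1 y.1 z) (x y : {x // x ∈ I.carrier}) :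
    {x // x ∈ I.carrier} :=
  ⟨(h x y).choose, I.sum_mem x.2 y.2 (h x y).choose_spec⟩

lemma isSum_addOfTotal (I : EffectIdeal E)
    (h : ∀ x y : {x // x ∈ I.carrier}, ∃ z, IsSum x.1 y.1 z) (x y : {x // x ∈ I.carrier}) :
    IsSum x.1 y.1 (I.addOfTotal h x y).1 := (h x y).choose_spec

/-- An ideal with total addition, as a cancellative monoid. -/
noncomputable abbrev addCancelCommMonoid (I : EffectIdeal E)
    (h : ∀ x y : {x // x ∈ I.carrier}, ∃ z, IsSum x.1 y.1 z) :
    AddCancelCommMonoid {x // x ∈ I.carrier} where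
  zero := ⟨0, I.zero_mem⟩
  add := I.addOfTotal h
  add_assoc x y z := by
    obtain ⟨f, hf, hf'⟩ := sum_assoc.1 ⟨_, I.isSum_addOfTotal h x y,
      I.isSum_addOfTotal h (I.addOfTotal h x y) z⟩
    have := EffectAlgebra.sum_unique hf (I.isSum_addOfTotal h y z)
    subst this
    exact Subtype.ext (EffectAlgebra.sum_unique hf' (I.isSum_addOfTotal h x (I.addOfTotal h y z)))
  add_comm x y := Subtype.ext <| EffectAlgebra.sum_unique (I.isSum_addOfTotal h x y)
    (EffectAlgebra.sum_comm (I.isSum_addOfTotal h y x))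
  zero_add x := Subtype.ext <| EffectAlgebra.sum_unique (I.isSum_addOfTotal h ⟨0, I.zero_mem⟩ x)
    (EffectAlgebra.sum_comm (EffectAlgebra.add_zero x.1))
  add_zero x := Subtype.ext <| EffectAlgebra.sum_unique (I.isSum_addOfTotal h x ⟨0, I.zero_mem⟩)
    (EffectAlgebra.add_zero x.1)
  add_left_cancel x y z hyz := by
    have hy := I.isSum_addOfTotal h x y
    rw [show I.addOfTotal h x y = I.addOfTotal h x z from hyz] at hy
    exact Subtype.ext (EffectAlgebra.add_left_cancel hy (I.isSum_addOfTotal h x z))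
  nsmul := @nsmulRec _ ⟨⟨0, I.zero_mem⟩⟩ ⟨I.addOfTotal h⟩

/-- An ideal with total addition in an effect algebra with RDP is the positive cone of a directed
po-group with RDP. -/
theorem exists_orderedGroup [RDP E] (I : EffectIdeal E)
    (h : ∀ x ∈ I.carrier, ∀ y ∈ I.carrier, ∃ z, IsSum x y z) :
    ∃ (G : Type u) (_ : AddCommGroup G) (_ : PartialOrder G) (_ : IsOrderedAddMonoid G)
      (ι : E → G), IsDirectedOrder G ∧ GroupRDP G ∧
      (∀ x ∈ I.carrier, ∀ y ∈ I.carrier, ι x = ι y → x = y) ∧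
      (∀ g, 0 ≤ g ↔ ∃ x ∈ I.carrier, ι x = g) ∧
      (∀ g, ∃ x ∈ I.carrier, ∃ y ∈ I.carrier, g = ι x - ι y) ∧
      ∀ x ∈ I.carrier, ∀ y ∈ I.carrier, ∀ z, IsSum x y z → ι x + ι y = ι z := by
  classical
  have h' : ∀ x y : {x // x ∈ I.carrier}, ∃ z, IsSum x.1 y.1 z := fun x y => h _ x.2 _ y.2
  let _ := I.addCancelCommMonoid h'
  have hadd : ∀ x y : {x // x ∈ I.carrier}, IsSum x.1 y.1 (x + y).1 := 
    I.isSum_addOfTotal h'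
  have hadd' : ∀ x y z : {x // x ∈ I.carrier}, IsSum x.1 y.1 z.1 → x + y = z := fun x y z hs =>
    Subtype.ext (EffectAlgebra.sum_unique (hadd x y) hs)
  have href : HasRefinement {x // x ∈ I.carrier} := by
    intro a₁ a₂ b₁ b₂ hs
    obtain ⟨c₁, c₂, c₃, c₄, e₁, e₂, e₃, e₄⟩ := RDP.decomposition (hadd a₁ a₂) (hs ▸ hadd b₁ b₂)
    have m₁ : c₁ ∈ I.carrier := I.mem_of_le ⟨_, e₁⟩ a₁.2
    have m₂ : c₂ ∈ I.carrier := I.mem_of_le ⟨_, EffectAlgebra.sum_comm e₁⟩ a₁.2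
    have m₃ : c₃ ∈ I.carrier := I.mem_of_le ⟨_, e₂⟩ a₂.2
    have m₄ : c₄ ∈ I.carrier := I.mem_of_le ⟨_, EffectAlgebra.sum_comm e₂⟩ a₂.2
    exact ⟨⟨c₁, m₁⟩, ⟨c₂, m₂⟩, ⟨c₃, m₃⟩, ⟨c₄, m₄⟩, (hadd' _ _ _ e₁).symm, (hadd' _ _ _ e₂).symm,
      (hadd' _ _ _ e₃).symm, (hadd' _ _ _ e₄).symm⟩
  obtain ⟨G, i₁, i₂, i₃, ι, hι, hpos, hgen⟩ :=
    exists_orderedGroup_of_conical {x // x ∈ I.carrier} fun x y hxy => Subtype.ext <| by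
      have := hadd x y
      rw [hxy] at this
      exact eq_zero_of_isSum_zero this
  have hdir : IsDirectedOrder G := ⟨fun g g' => by
    obtain ⟨m, n, rfl⟩ := hgen g
    obtain ⟨m', n', rfl⟩ := hgen g'
    have hp : ∀ x, 0 ≤ ι x := fun x => (hpos _).2 ⟨x, rfl⟩
    exact ⟨ι m + ι m', (sub_le_self _ (hp n)).trans (le_add_of_nonneg_right (hp m')),
      (sub_le_self _ (hp n')).trans (le_add_of_nonneg_left (hp m))⟩⟩
  have hval : ∀ x : {x // x ∈ I.carrier},
      (fun x : E => if hx : x ∈ I.carrier then ι ⟨x, hx⟩ else 0) x.1 = ι x :=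
    fun x => dif_pos x.2
  -- `ι` is made total on `E` for convenience; all its properties concern elements of `I`, so the
  -- value `0` elsewhere plays no role.
  refine ⟨G, i₁, i₂, i₃, fun x => if hx : x ∈ I.carrier then ι ⟨x, hx⟩ else 0, hdir,
    href.groupRDP hι hpos, ?_, ?_, ?_, ?_⟩
  · intro x hx y hy hxy
    exact congrArg Subtype.val (hι ((hval ⟨x, hx⟩).symm.trans (hxy.trans (hval ⟨y, hy⟩))))
  · refine fun g => (hpos g).trans ⟨?_, ?_⟩
    · rintro ⟨x, rfl⟩
      exact ⟨x.1, x.2, hval x⟩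
    · rintro ⟨x, hx, rfl⟩
      exact ⟨⟨x, hx⟩, (hval ⟨x, hx⟩).symm⟩
  · intro g
    obtain ⟨m, n, rfl⟩ := hgen g
    exact ⟨m.1, m.2, n.1, n.2, by rw [hval, hval]⟩
  · intro x hx y hy z hz
    have := hadd' ⟨x, hx⟩ ⟨y, hy⟩ ⟨z, I.sum_mem hx hy hz⟩ hz
    exact (congrArg₂ (· + ·) (hval ⟨x, hx⟩) (hval ⟨y, hy⟩)).trans
      ((map_add ι _ _).symm.trans ((congrArg ι this).trans (hval ⟨z, I.sum_mem hx hy hz⟩).symm))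

/-! ### Offsets and the lexicographic representation -/

/-- `x` and `s` have a common lower bound in their coset, and `x - s`, evaluated by `ι`, is `g`. -/
def HasOffset (I : EffectIdeal E) {G : Type v} [AddCommGroup G] (ι : E → G) (s x : E) (g : G) :
    Prop :=
  ∃ e ∈ I.carrier, ∃ f ∈ I.carrier, ∃ d, IsSum e d x ∧ IsSum f d s ∧ g = ι e - ι f

/-- Taken with `x = y` this makes the offset independent of its witnesses; the converse direction
makes it injective on a coset. Refining `s = f + d = f' + d'` yields a part `t` common to `d` and
`d'`, so that `x` is `t` plus `e + r` and `y` is `t` plus `e' + q`. Comparing these two elements of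
`I` under `ι` amounts to comparing the offsets. -/
lemma HasOffset.eq_iff [RDP E] {I : EffectIdeal E} {G : Type v} [AddCommGroup G] {ι : E → G}
    (hinj : ∀ x ∈ I.carrier, ∀ y ∈ I.carrier, ι x = ι y → x = y)
    (hadd : ∀ x ∈ I.carrier, ∀ y ∈ I.carrier, ∀ z, IsSum x y z → ι x + ι y = ι z)
    {s x y : E} {g g' : G} (h : I.HasOffset ι s x g) (h' : I.HasOffset ι s y g') :
    x = y ↔ g = g' := by
  obtain ⟨e, he, f, hf, d, h₁, h₂, rfl⟩ := h
  obtain ⟨e', he', f', hf', d', h₁', h₂', rfl⟩ := h'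
  obtain ⟨p, q, r, t, k₁, k₂, k₃, k₄⟩ := RDP.decomposition h₂ h₂'
  have hp : p ∈ I.carrier := I.mem_of_le ⟨_, k₁⟩ hf
  have hq : q ∈ I.carrier := I.mem_of_le ⟨_, EffectAlgebra.sum_comm k₁⟩ hf
  have hr : r ∈ I.carrier := I.mem_of_le ⟨_, EffectAlgebra.sum_comm k₃⟩ hf'
  obtain ⟨m, hm, hm'⟩ := sum_assoc.2 ⟨d, k₂, h₁⟩
  obtain ⟨n, hn, hn'⟩ := sum_assoc.2 ⟨d', k₄, h₁'⟩
  have hmn : x = y ↔ m = n := by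
    constructor
    · rintro rfl
      exact EffectAlgebra.add_left_cancel (EffectAlgebra.sum_comm hm') (EffectAlgebra.sum_comm hn')
    · rintro rfl
      exact EffectAlgebra.sum_unique hm' hn'
  have hmn' : m = n ↔ ι m = ι n :=
    ⟨congrArg ι, hinj _ (I.sum_mem he hr hm) _ (I.sum_mem he' hq hn)⟩
  rw [hmn, hmn', ← hadd _ he _ hr _ hm, ← hadd _ he' _ hq _ hn, ← hadd _ hp _ hq _ k₁,
    ← hadd _ hp _ hr _ k₃, sub_eq_sub_iff_add_eq_add]
  constructor
  · intro h
    rw [show ι e + (ι p + ι r) = (ι e + ι r) + ι p by abel, h]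
    abel
  · intro h
    refine add_right_cancel (b := ι p) ?_
    rw [show ι e + ι r + ι p = ι e + (ι p + ι r) by abel, h]
    abel

lemma HasOffset.add {I : EffectIdeal E} {G : Type v} [AddCommGroup G] {ι : E → G}
    (hadd : ∀ x ∈ I.carrier, ∀ y ∈ I.carrier, ∀ z, IsSum x y z → ι x + ι y = ι z)
    {s s' t x y z : E} {g g' : G} (h : I.HasOffset ι s x g) (h' : I.HasOffset ι s' y g')
    (hs : IsSum s s' t) (hx : IsSum x y z) : I.HasOffset ι t z (g + g') := by
  obtain ⟨e, he, f, hf, d, h₁, h₂, rfl⟩ := h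
  obtain ⟨e', he', f', hf', d', h₁', h₂', rfl⟩ := h'
  obtain ⟨m, n, hm, hn, hmn⟩ := isSum_add_add_comm h₁ h₁' hx
  obtain ⟨m', n', hm', hn', hmn'⟩ := isSum_add_add_comm h₂ h₂' hs
  have : n = n' := EffectAlgebra.sum_unique hn hn'
  subst this
  refine ⟨m, I.sum_mem he he' hm, m', I.sum_mem hf hf' hm', n, hmn, hmn', ?_⟩
  rw [← hadd _ he _ he' _ hm, ← hadd _ hf _ hf' _ hm']
  abel

end EffectIdeal

/-- An effect algebra with a strict and retractive ideal is a lexicographic interval, whose first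
coordinate is given by the quotient and whose second coordinate is given by the ideal. -/
theorem EffectIdeal.exists_lex_iso {E : Type u} [EffectAlgebra E] [RDP E] {I : EffectIdeal E}
    (hne : I.carrier ≠ Set.univ) (hI : I.IsStrict) (hI' : I.IsRetractive) {H : Type v}
    [AddCommGroup H] [PartialOrder H] [IsOrderedAddMonoid H] {a : H} (ha : 0 ≤ a)
    (φ : EffectIso I.Quotient (Gam a ha)) :
    ∃ (G : Type u) (_ : AddCommGroup G) (_ : PartialOrder G) (_ : IsOrderedAddMonoid G),
      IsDirectedOrder G ∧ GroupRDP G ∧ ∃ ψ : EffectIso E (Gam (lexUnit G a) (lexUnit_nonneg G ha)),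
        ∀ x, (ψ.coord x).1 = (φ.toFun (I.proj x)).1 := by
  have h01 := zero_ne_one_of_ne_univ hne
  have htotal : ∀ x ∈ I.carrier, ∀ y ∈ I.carrier, ∃ z, IsSum x y z := fun x hx y hy =>
    hI.exists_isSum_of_mem hy (by rwa [I.proj_eq_zero_iff.2 hx])
  obtain ⟨G, _, _, _, ι, hdir, hG, hinj, hpos, hgen, hadd⟩ := I.exists_orderedGroup htotal
  obtain ⟨δ, hδ⟩ := hI'
  have hzero : ι 0 = 0 := by
    simpa using hadd 0 I.zero_mem 0 I.zero_mem 0 (EffectAlgebra.add_zero 0)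
  have hιpos : ∀ x ∈ I.carrier, 0 ≤ ι x := fun x hx => (hpos _).2 ⟨x, hx, rfl⟩
  have hφ0 : φ.toFun 0 = 0 := φ.toHom.map_zero
  -- The offset is measured from the representative `δ(x/I)` of the coset of `x`.
  have hex : ∀ x, ∃ g, I.HasOffset ι (δ.toFun (I.proj x)) x g := fun x => by
    obtain ⟨e, he, f, hf, d, h₁, h₂⟩ := I.proj_eq.1 (hδ (I.proj x)).symm
    exact ⟨_, e, he, f, hf, d, h₁, h₂, rfl⟩
  choose g hg using hex
  have hg_eq : ∀ {x g'}, I.HasOffset ι (δ.toFun (I.proj x)) x g' → g x = g' := fun {x g'} h =>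
    ((hg x).eq_iff hinj hadd h).1 rfl
  have hg_nonneg : ∀ x, I.proj x = 0 → 0 ≤ g x := by
    intro x hx
    obtain ⟨e, he, f, hf, d, h₁, h₂, h₃⟩ := hg x
    rw [hx, δ.map_zero] at h₂
    rw [h₃, eq_zero_of_isSum_zero h₂, hzero, sub_zero]
    exact hιpos e he
  have hg_nonpos : ∀ x, I.proj x = 1 → g x ≤ 0 := by
    intro x hx
    obtain ⟨e, he, f, hf, d, h₁, h₂, h₃⟩ := hg x
    rw [hx, δ.map_one] at h₂
    -- In the top coset the base point is `1`, so `f` is the sum of the complement of `x` and `e`;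
    -- the offset is minus the value of that complement.
    obtain ⟨k, hk, hk'⟩ := sum_assoc.2 ⟨x, h₁, EffectAlgebra.sum_comm (sum_compl x)⟩
    have hkf : k = f :=
      EffectAlgebra.add_left_cancel (EffectAlgebra.sum_comm hk') (EffectAlgebra.sum_comm h₂)
    subst hkf
    have hc := I.mem_of_le ⟨_, hk⟩ hf
    rw [h₃, ← hadd _ hc _ he _ hk, sub_add_cancel_right]
    exact neg_nonpos.2 (hιpos _ hc)
  have hsum : ∀ {x y z}, IsSum x y z → g x + g y = g z := fun {x y z} h =>
    (hg_eq ((hg x).add hadd (hg y) (δ.map_add (I.proj_isSum h)) h)).symm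
  have hsum' : ∀ {x y z}, IsSum (I.proj x) (I.proj y) (I.proj z) → g x + g y = g z →
      IsSum x y z := by
    intro x y z hp hgz
    have hs := δ.map_add hp
    obtain ⟨e, he, f, hf, d, h₁, h₂, h₃⟩ := hg x
    obtain ⟨e', he', f', hf', d', h₁', h₂', h₃'⟩ := hg y
    -- To build `x + y`, remove `m = f + f'` from the sum of the two base points, leaving `n = d +
    -- d'`, and add `k = e + e'` instead. Regrouping turns `n + k` into `x + y`.
    obtain ⟨m, n, hm, hn, hmn⟩ := isSum_add_add_comm h₂ h₂' hs
    obtain ⟨k, hk⟩ := htotal e he e' he'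
    have hkI := I.sum_mem he he' hk
    have hmI := I.sum_mem hf hf' hm
    have hdef : ∃ w, IsSum n k w := by
      -- Outside the top coset strictness allows `k` to be added to `n`. In the top coset `n` is the
      -- complement of `m`, and the nonpositive offset of `z` gives `k ≤ m`.
      by_cases hz : I.proj z = 1
      · rw [hz, δ.map_one] at hmn
        have hle := hg_nonpos z hz
        rw [← hgz, h₃, h₃'] at hle
        obtain ⟨j, hj, hj'⟩ := (hpos (ι m - ι k)).1 <| by
          rw [← hadd _ he _ he' _ hk, ← hadd _ hf _ hf' _ hm, ← neg_nonpos]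
          convert hle using 1
          abel
        obtain ⟨i, hi⟩ := htotal k hkI j hj
        have him : i = m := hinj _ (I.sum_mem hkI hj hi) _ hmI <| by
          rw [← hadd _ hkI _ hj _ hi, hj', add_sub_cancel]
        subst him
        obtain ⟨w, hw, -⟩ := sum_assoc.2 ⟨i, hi, EffectAlgebra.sum_comm hmn⟩
        exact ⟨w, hw⟩
      · refine hI.exists_isSum_of_mem hkI ?_
        rwa [← I.proj_add_mem hmI hmn, hδ]
    obtain ⟨w, hw⟩ := hdef
    obtain ⟨x', y', hx', hy', hw'⟩ := isSum_add_add_comm hk hn (EffectAlgebra.sum_comm hw)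
    have hxx : x' = x := EffectAlgebra.sum_unique hx' h₁
    have hyy : y' = y := EffectAlgebra.sum_unique hy' h₁'
    subst hxx hyy
    have hpw : I.proj w = I.proj z := EffectAlgebra.sum_unique (I.proj_isSum hw') hp
    -- The sum `w` of `x` and `y` has the coset and the offset of `z`.
    have hwz : w = z := by
      have h := hg w
      rw [hpw] at h
      exact (h.eq_iff hinj hadd (hg z)).2 ((hsum hw').symm.trans hgz)
    rwa [hwz] at hw'
  -- The preimage is `δ q - n + m`. Nothing but `0` can be subtracted when `q = 0`, since `δ 0 = 0`;
  -- for `q = 1` taking `m = 0` avoids adding at the top.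
  have hsurj : ∀ q : I.Quotient, ∀ m ∈ I.carrier, ∀ n ∈ I.carrier, (q = 0 → n = 0) →
      (q = 1 → m = 0) → ∃ x, I.proj x = q ∧ g x = ι m - ι n := by
    intro q m hm n hn hq hq'
    have hle : le n (δ.toFun q) := by
      by_cases h : q = 0
      · rw [hq h]
        exact ⟨_, EffectAlgebra.sum_comm (EffectAlgebra.add_zero _)⟩
      · exact hI.le_of_mem hn (by rwa [hδ])
    obtain ⟨d, hd⟩ := hle
    have hdq : I.proj d = q := by rw [← I.proj_add_mem hn hd, hδ]
    have hdef : ∃ x, IsSum d m x := by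
      by_cases h : q = 1
      · rw [hq' h]
        exact ⟨_, EffectAlgebra.add_zero _⟩
      · exact hI.exists_isSum_of_mem hm (by rwa [hdq])
    obtain ⟨x, hx⟩ := hdef
    have hxq : I.proj x = q := (I.proj_add_mem hm (EffectAlgebra.sum_comm hx)).trans hdq
    exact ⟨x, hxq, hg_eq ⟨m, hm, n, hn, d, EffectAlgebra.sum_comm hx, by rwa [hxq], rfl⟩⟩
  have hφ : ∀ {q : I.Quotient} {t : Gam a ha}, (φ.toFun q).1 = t.1 ↔ q = φ.symm.toFun t := by
    intro q t
    constructor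
    · intro h
      exact (φ.left_inv q).symm.trans (congrArg φ.symm.toFun (Subtype.ext h))
    · rintro rfl
      exact congrArg Subtype.val (φ.right_inv t)
  have hφ0' : ∀ {q : I.Quotient}, (φ.toFun q).1 = 0 ↔ q = 0 := fun {q} => by
    rw [← φ.injective.eq_iff]
    exact (Subtype.ext_iff.trans (Eq.congr_right (congrArg Subtype.val hφ0))).symm
  have hφ1' : ∀ {q : I.Quotient}, (φ.toFun q).1 = a ↔ q = 1 := fun {q} => by
    rw [← φ.injective.eq_iff]
    exact (Subtype.ext_iff.trans (Eq.congr_right (congrArg Subtype.val φ.map_one))).symm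
  let f : E → Gam (lexUnit G a) (lexUnit_nonneg G ha) := fun x =>
    ⟨toLex ((φ.toFun (I.proj x)).1, g x),
      lex_nonneg_iff.2 ⟨(φ.toFun (I.proj x)).2.1, fun h => hg_nonneg x (hφ0'.1 h)⟩,
      lex_le_unit_iff.2 ⟨(φ.toFun (I.proj x)).2.2, fun h => hg_nonpos x (hφ1'.1 h)⟩⟩
  refine ⟨G, _, _, inferInstance, hdir, hG, EffectIso.ofBijective f ⟨?_, ?_⟩ ?_ ?_, fun _ => rfl⟩
  · intro x y hxy
    have h₁ : (φ.toFun (I.proj x)).1 = (φ.toFun (I.proj y)).1 :=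
      congrArg (fun w => (ofLex w.1).1) hxy
    have h₂ : g x = g y := congrArg (fun w => (ofLex w.1).2) hxy
    have h := hg x
    rw [φ.injective (Subtype.ext h₁)] at h
    exact (h.eq_iff hinj hadd (hg y)).2 h₂
  · rintro ⟨⟨t, k⟩, h₁, h₂⟩
    obtain ⟨ht, hk⟩ := lex_nonneg_iff.1 h₁
    obtain ⟨ht', hk'⟩ := lex_le_unit_iff.1 h₂
    dsimp only at ht hk ht' hk'
    obtain ⟨q, hq⟩ := φ.surjective ⟨t, ht, ht'⟩
    replace hq : (φ.toFun q).1 = t := congrArg Subtype.val hq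
    -- The sign of `k` on the bottom and top levels allows one of `m`, `n` to be `0`. The two cases
    -- do not collide because `I ≠ E` makes `0 ≠ 1` in the quotient.
    have hmn : ∃ m ∈ I.carrier, ∃ n ∈ I.carrier, (q = 0 → n = 0) ∧ (q = 1 → m = 0) ∧
        k = ι m - ι n := by
      by_cases hq0 : q = 0
      · obtain ⟨m, hm, hmk⟩ := (hpos k).1 (hk (hq.symm.trans (hφ0'.2 hq0)))
        exact ⟨m, hm, 0, I.zero_mem, fun _ => rfl, fun h => absurd (hq0.symm.trans h) h01,
          by rw [hmk, hzero, sub_zero]⟩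
      · by_cases hq1 : q = 1
        · obtain ⟨n, hn, hnk⟩ := (hpos (-k)).1
            (neg_nonneg.2 (hk' (hq.symm.trans (hφ1'.2 hq1))))
          exact ⟨0, I.zero_mem, n, hn, fun h => absurd h hq0, fun _ => rfl,
            by rw [hnk, hzero, zero_sub, neg_neg]⟩
        · obtain ⟨m, hm, n, hn, h⟩ := hgen k
          exact ⟨m, hm, n, hn, fun h => absurd h hq0, fun h => absurd h hq1, h⟩
    obtain ⟨m, hm, n, hn, hn0, hm0, rfl⟩ := hmn
    obtain ⟨x, hx, hgx⟩ := hsurj q m hm n hn hn0 hm0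
    refine ⟨x, Subtype.ext (ofLex.injective (Prod.ext ?_ hgx))⟩
    change (φ.toFun (I.proj x)).1 = t
    rw [hx, hq]
  · refine Subtype.ext (ofLex.injective (Prod.ext (congrArg Subtype.val φ.map_one) ?_))
    refine hg_eq ⟨0, I.zero_mem, 0, I.zero_mem, 1, ?_, ?_, (sub_self _).symm⟩
    · exact EffectAlgebra.sum_comm (EffectAlgebra.add_zero _)
    · rw [show I.proj 1 = 1 from rfl, δ.map_one]
      exact EffectAlgebra.sum_comm (EffectAlgebra.add_zero _)
  · intro x y z
    constructor
    · intro h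
      exact ofLex.injective (Prod.ext (φ.map_add (I.proj_isSum h)) (hsum h))
    · intro h
      exact hsum' (φ.isSum_iff.2 (congrArg (fun w => (ofLex w).1) h))
        (congrArg (fun w => (ofLex w).2) h)

/-! ### Assembly of the three statements -/

theorem theorem6p7 {E : Type u} [EffectAlgebra E] :
    (∀ [EffectAlgebra.RDP E] (I : EffectIdeal E), I.carrier ≠ Set.univ →
      I.IsStrict → I.IsRetractive →
      ∃ (H : Type u) (_ : AddCommGroup H) (_ : PartialOrder H) (_ : IsOrderedAddMonoid H)
        (a : H) (ha : IsStrongUnit a),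
        GroupRDP H ∧ Nonempty (EffectIso I.Quotient (Gam a ha.1)) ∧
        ∃ (G : Type u) (_ : AddCommGroup G) (_ : PartialOrder G) (_ : IsOrderedAddMonoid G),
          IsDirectedOrder G ∧ GroupRDP G ∧
          Nonempty (EffectIso (EffectSubalgebra.generated I.carrier).Elem
            (Gam (lexUnit G (1 : ℤ)) (lexUnit_nonneg G zero_le_one))) ∧
          Nonempty (EffectIso E (Gam (lexUnit G a) (lexUnit_nonneg G ha.1)))) ∧
    (∀ (H : Type v) [AddCommGroup H] [PartialOrder H] [IsOrderedAddMonoid H] [Nontrivial H]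
      (a : H) (ha : IsStrongUnit a)
      (G : Type w) [AddCommGroup G] [PartialOrder G] [IsOrderedAddMonoid G] [IsDirectedOrder G],
      GroupRDP H → GroupRDP G →
      Nonempty (EffectIso E (Gam (lexUnit G a) (lexUnit_nonneg G ha.1))) →
      ∃ (_ : EffectAlgebra.RDP E) (I : EffectIdeal E), I.carrier ≠ Set.univ ∧
        I.IsStrict ∧ I.IsRetractive ∧
        Nonempty (EffectIso I.Quotient (Gam a ha.1)) ∧
        Nonempty (EffectIso (EffectSubalgebra.generated I.carrier).Elem
          (Gam (lexUnit G (1 : ℤ)) (lexUnit_nonneg G zero_le_one)))) ∧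
    (∀ [EffectAlgebra.RDP E] (H : Type v) [AddCommGroup H] [PartialOrder H]
      [IsOrderedAddMonoid H] (a : H) (ha : IsStrongUnit a),
      IsStrongPerfect E a ↔
        ∃ I : EffectIdeal E, I.IsStrict ∧ I.IsRetractive ∧
          Nonempty (EffectIso I.Quotient (Gam a ha.1))) := by
  refine ⟨?_, ?_, ?_⟩
  · intro _ I hne hI hI'
    obtain ⟨H, _, _, _, a, ha, hH, ⟨φ⟩⟩ := exists_unitalGroup I.Quotient
    obtain ⟨G, _, _, _, hdir, hG, ψ, hψ⟩ := EffectIdeal.exists_lex_iso hne hI hI' ha.1 φ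
    have hφ0 : ∀ q : I.Quotient, (φ.toFun q).1 = 0 ↔ q = 0 := fun q => by
      rw [← φ.injective.eq_iff]
      exact (Subtype.ext_iff.trans
        (Eq.congr_right (congrArg Subtype.val φ.toHom.map_zero))).symm
    have ha' : a ≠ 0 := by
      intro h
      refine EffectIdeal.zero_ne_one_of_ne_univ hne ((hφ0 1).1 ?_).symm
      exact (congrArg Subtype.val φ.map_one).trans h
    refine ⟨H, _, _, inferInstance, a, ha, hH, ⟨φ⟩, G, _, _, inferInstance, hdir, hG, ?_, ⟨ψ⟩⟩
    -- The first coordinate of `ψ` is the coset under `φ`, so `I` is precisely the bottom level of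
    -- `ψ`.
    refine ψ.nonempty_generated_iso ha' (Set.ext fun x => ?_)
    change _ ↔ (ψ.coord x).1 = 0
    rw [hψ, hφ0, I.proj_eq_zero_iff]
  · intro H _ _ _ _ a ha G _ _ _ _ hH hG ⟨φ⟩
    have := (hH.lex hG).rdp_gam (lexUnit_nonneg G ha.1)
    have := φ.rdp
    exact ⟨this, exists_strict_retractive_of_lex ha.1 ha.ne_zero φ⟩
  · intro _ H _ _ _ a ha
    exact isStrongPerfect_iff ha.1
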